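/- Let $R$ be an integral domain with quotient field $K$. Then the following are equivalent. 1. $R$ is a TAF-domain, i.e. every proper ideal of $R$ is a finite product of 2-absorbing ideals, where an ideal $I$ of $R$ is 2-absorbing if for all $a,b,c\in R$ with $abc\in I$ one has $ab\in I$, $ac\in I$ or $bc\in I$. 2. $R$ has finite character (each nonzero nonunit of $R$ lies in only finitely many maximal ideals), and $R_M$ is a Mori pseudo-valuation domain for each maximal ideal $M$ of $R$. 3. $R$ is a Mori locally pseudo-valuation domain. 4. $R$ is a seminormal Mori locally conducive domain. Moreover, if $R$ satisfies these equivalent conditions, then $R$ has Krull dimension at most $1$. Here, for an integral domain $D$ with quotient field $F$: $D$ is a *pseudo-valuation domain* if every prime ideal $P$ of $D$ is strongly prime, i.e. whenever $x,y\in F$ and $xy\in P$, then $x\in P$ or $y\in P$; $D$ is *Mori* if it satisfies the ascending chain condition on divisorial ideals, i.e. on nonzero ideals $I$ of $D$ with $D:(D:I)=I$, where $D:J=\{x\in F\mid xJ\subseteq D\}$; $D$ is *seminormal* if $x\in F$ and $x^2,x^3\in D$ imply $x\in D$; $D$ is *conducive* if every ring $T$ with $D\subseteq T\subsetneq F$ is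 a fractional ideal of $D$, i.e. $aT\subseteq D$ for some nonzero $a\in D$; and $D$ is *locally pseudo-valuation* (respectively *locally conducive*) if $D_M$ is a pseudo-valuation domain (respectively conducive) for each maximal ideal $M$ of $D$. -/

import Mathlib

/-! Ring-theoretic notions for an integral domain `R` with quotient field `K = FractionRing R`.
The definitions are stated for commutative rings so that they apply to localizations without
instance arguments; they are meant for integral domains. -/

namespace TAF

open scoped nonZeroDivisors

/-- A 2-absorbing ideal. -/
def IsTwoAbsorbing {R : Type*} [CommRing R] (I : Ideal R) : Prop :=
  ∀ a b c : R, a * b * c ∈ I → a * b ∈ I ∨ a * c ∈ I ∨ b * c ∈ I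

/-- A TAF-ring: every proper ideal is a finite product of 2-absorbing ideals. -/
def IsTAFRing (R : Type*) [CommRing R] : Prop :=
  ∀ I : Ideal R, I ≠ ⊤ →
    ∃ s : Multiset (Ideal R), (∀ J ∈ s, IsTwoAbsorbing J) ∧ s.prod = I

/-- Finite character: each nonzero nonunit lies in only finitely many maximal ideals. -/
def HasFiniteCharacter (R : Type*) [CommRing R] : Prop :=
  ∀ x : R, x ≠ 0 → ¬ IsUnit x → {M : Ideal R | M.IsMaximal ∧ x ∈ M}.Finite

/-- The image in the quotient field of an ideal `I` of `R`. -/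
abbrev inK {R : Type*} [CommRing R] (I : Ideal R) : Submodule R (FractionRing R) :=
  IsLocalization.coeSubmodule (FractionRing R) I

/-- A strongly prime ideal: for `x, y ∈ K` with `x * y ∈ I`, one has `x ∈ I` or `y ∈ I`. -/
def IsStronglyPrime {R : Type*} [CommRing R] (I : Ideal R) : Prop :=
  ∀ x y : FractionRing R, x * y ∈ inK I → x ∈ inK I ∨ y ∈ inK I

/-- A pseudo-valuation domain (PVD): every prime ideal is strongly prime. -/
def IsPVD (R : Type*) [CommRing R] : Prop :=
  ∀ P : Ideal R, P.IsPrime → IsStronglyPrime P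

/-- A locally pseudo-valuation domain (LPVD). -/
def IsLPVD (R : Type*) [CommRing R] : Prop :=
  ∀ (M : Ideal R) [M.IsMaximal], IsPVD (Localization.AtPrime M)

/-- A divisorial ideal: a nonzero ideal `I` of `R` with `R : (R : I) = I`. Here `1` is the
submodule `R` of `K`, and `A / B = {x ∈ K | x B ⊆ A}` for submodules `A`, `B` of `K`. -/
def IsDivisorial {R : Type*} [CommRing R] (I : Ideal R) : Prop :=
  I ≠ ⊥ ∧ (1 : Submodule R (FractionRing R)) / (1 / inK I) = inK I

/-- A Mori domain: the ascending chain condition on divisorial ideals. -/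
def IsMori (R : Type*) [CommRing R] : Prop :=
  WellFoundedGT {I : Ideal R // IsDivisorial I}

/-- A seminormal domain: if `x ∈ K` and `x ^ 2, x ^ 3 ∈ R`, then `x ∈ R`. -/
def IsSeminormal (R : Type*) [CommRing R] : Prop :=
  ∀ x : FractionRing R,
    x ^ 2 ∈ (algebraMap R (FractionRing R)).range →
    x ^ 3 ∈ (algebraMap R (FractionRing R)).range →
    x ∈ (algebraMap R (FractionRing R)).range

/-- A conducive domain: each overring `T` of `R` (a subring of `K` containing `R`) other than `K`
is a fractional ideal of `R`, i.e. `a T ⊆ R` for some nonzero `a`. -/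
def IsConducive (R : Type*) [CommRing R] : Prop :=
  ∀ T : Subalgebra R (FractionRing R), T ≠ ⊤ → IsFractional R⁰ (Subalgebra.toSubmodule T)

/-- A locally conducive domain. -/
def IsLocallyConducive (R : Type*) [CommRing R] : Prop :=
  ∀ (M : Ideal R) [M.IsMaximal], IsConducive (Localization.AtPrime M)

end TAF

/-! Write `m` for the maximal ideal of a local domain `D`. If `D` is a Mori PVD and not a field,
some `t ∈ m` satisfies `m² ⊆ t m`. Dividing a nonzero proper ideal by `t` until it no longer lies in
`t m` leaves an ideal containing `m²`, and such ideals are 2-absorbing (`IsPVD.exists_prod_eq`).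
Finite character lets the contracted local factors be multiplied together.

Conversely, a proper 2-absorbing ideal contains a product of two primes lying over it. The hard
point is that nonzero primes of a TAF-domain are maximal. Otherwise a localization has a prime `P ≠
m`, an `a ∈ m \ P` with `m` minimal over `P + (a)`, and a nonzero principal 2-absorbing ideal `(p) ⊆
P` containing `P²` or `a P`. Factoring `P + (a³)` gives `P = P m`, hence `P = P² + a P`, which is
incompatible with such a `p`. In dimension one, every nonzero `x` of a local TAF-domain has an order
`n`, with `x m = m^(n+1)`; comparing orders gives both the PVD and the Mori property.

The Mori property localizes because every nonzero ideal has the same divisorial closure as some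
finitely generated subideal, and it globalizes under finite character. In a Mori LPVD all nonzero
maximal ideals are divisorial, and only finitely many divisorial maximal ideals contain a given
nonzero element.

Finally, a PVD is seminormal, and a Mori PVD is conducive because its dimension is at most one. In
the other direction, the conductor of a valuation ring dominating `D` is nonzero by conducivity,
prime by seminormality, and contains `m` by the Mori property, which makes `m` strongly prime. -/

namespace TAF

open scoped nonZeroDivisors

/-! ### Quotient-field notions with denominators cleared. -/

section Internal

variable {R : Type*} [CommRing R]

/-- The divisorial closure of an ideal of a domain, written without the quotient field. -/
def vcl (I : Ideal R) : Ideal R where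
  carrier := {y | ∀ c d : R, d ≠ 0 → (∀ x ∈ I, d ∣ c * x) → d ∣ c * y}
  add_mem' := fun hx hy c d hd h => by
    rw [mul_add]; exact dvd_add (hx c d hd h) (hy c d hd h)
  zero_mem' := fun c d _ _ => by simp
  smul_mem' := fun r _ hy c d hd h => by
    rw [smul_eq_mul, mul_left_comm]; exact (hy c d hd h).mul_left r

theorem le_vcl (I : Ideal R) : I ≤ vcl I := fun _ hx _ _ _ h => h _ hx

theorem vcl_le_vcl {I J : Ideal R} (h : I ≤ vcl J) : vcl I ≤ vcl J :=
  fun _ hy c d hd hc => hy c d hd fun _ hx => h hx c d hd hc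

theorem vcl_mono {I J : Ideal R} (h : I ≤ J) : vcl I ≤ vcl J := vcl_le_vcl (h.trans (le_vcl J))

variable [IsDomain R]

theorem exists_eq_div (z : FractionRing R) :
    ∃ a b : R, b ≠ 0 ∧ z * algebraMap R (FractionRing R) b = algebraMap R (FractionRing R) a := by
  obtain ⟨⟨a, b⟩, h⟩ := IsLocalization.surj R⁰ z
  exact ⟨a, b, nonZeroDivisors.ne_zero b.2, h⟩

omit [IsDomain R] in
theorem algebraMap_fractionRing_injective :
    Function.Injective (algebraMap R (FractionRing R)) := IsFractionRing.injective R _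

theorem mem_range_iff_dvd {z : FractionRing R} {a b : R} (hb : b ≠ 0)
    (h : z * algebraMap R (FractionRing R) b = algebraMap R (FractionRing R) a) :
    z ∈ (algebraMap R (FractionRing R)).range ↔ b ∣ a := by
  have hb' : algebraMap R (FractionRing R) b ≠ 0 := by
    simpa using hb
  constructor
  · rintro ⟨r, rfl⟩
    rw [← map_mul] at h
    exact ⟨r, by rw [← algebraMap_fractionRing_injective h, mul_comm]⟩
  · rintro ⟨r, rfl⟩
    refine ⟨r, mul_right_cancel₀ hb' ?_⟩
    rw [h, map_mul, mul_comm]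

omit [IsDomain R] in
theorem mem_inK {I : Ideal R} {z : FractionRing R} :
    z ∈ inK I ↔ ∃ p ∈ I, algebraMap R (FractionRing R) p = z :=
  IsLocalization.mem_coeSubmodule _ _

theorem mem_inK_iff {I : Ideal R} {z : FractionRing R} {a b : R} (hb : b ≠ 0)
    (h : z * algebraMap R (FractionRing R) b = algebraMap R (FractionRing R) a) :
    z ∈ inK I ↔ ∃ p ∈ I, a = b * p := by
  have hb' : algebraMap R (FractionRing R) b ≠ 0 := by
    simpa using hb
  rw [mem_inK]
  refine exists_congr fun p => and_congr_right fun _ => ⟨?_, ?_⟩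
  · rintro rfl
    rw [← map_mul] at h
    rw [← algebraMap_fractionRing_injective h, mul_comm]
  · rintro rfl
    refine mul_right_cancel₀ hb' ?_
    rw [h, map_mul, mul_comm]

theorem algebraMap_mem_inK {I : Ideal R} {x : R} :
    algebraMap R (FractionRing R) x ∈ inK I ↔ x ∈ I := by
  rw [mem_inK_iff (a := x) one_ne_zero (by simp)]
  simp

theorem mem_one_div_inK {I : Ideal R} {z : FractionRing R} {c d : R} (hd : d ≠ 0)
    (h : z * algebraMap R (FractionRing R) d = algebraMap R (FractionRing R) c) :
    z ∈ (1 : Submodule R (FractionRing R)) / inK I ↔ ∀ x ∈ I, d ∣ c * x := by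
  rw [Submodule.mem_div_iff_forall_mul_mem]
  have key : ∀ x : R, z * algebraMap R (FractionRing R) x ∈ (1 : Submodule R (FractionRing R)) ↔
      d ∣ c * x := fun x => by
    rw [Submodule.mem_one]
    exact mem_range_iff_dvd (z := z * algebraMap R (FractionRing R) x) hd
      (by rw [mul_right_comm, h, map_mul])
  constructor
  · intro H x hx
    exact (key x).1 (H _ (algebraMap_mem_inK.2 hx))
  · intro H y hy
    obtain ⟨x, hx, rfl⟩ := mem_inK.1 hy
    exact (key x).2 (H x hx)

/-- The fractions `c / d` in the definition of `vcl` run over `R : I`. Since `1` is among them, the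
double dual already lies in `R`. -/
theorem mem_one_div_one_div_inK {I : Ideal R} {z : FractionRing R} :
    z ∈ (1 : Submodule R (FractionRing R)) / (1 / inK I) ↔
      ∃ y ∈ vcl I, algebraMap R (FractionRing R) y = z := by
  rw [Submodule.mem_div_iff_forall_mul_mem]
  constructor
  · intro H
    have h1 : (1 : FractionRing R) ∈ (1 : Submodule R (FractionRing R)) / inK I :=
      (mem_one_div_inK (c := 1) one_ne_zero (by simp)).2 (by simp)
    obtain ⟨y, hy⟩ := Submodule.mem_one.1 (mul_one z ▸ H 1 h1)
    refine ⟨y, fun c d hd hc => ?_, hy⟩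
    have hd' : algebraMap R (FractionRing R) d ≠ 0 := by simpa using hd
    have hz : (algebraMap R (FractionRing R) c / algebraMap R (FractionRing R) d) *
        algebraMap R (FractionRing R) d = algebraMap R (FractionRing R) c :=
      div_mul_cancel₀ _ hd'
    have := H _ ((mem_one_div_inK hd hz).2 hc)
    rw [Submodule.mem_one] at this
    refine (mem_range_iff_dvd hd ?_).1 this
    rw [mul_assoc, hz, ← hy, map_mul, mul_comm]
  · rintro ⟨y, hy, rfl⟩ w hw
    obtain ⟨c, d, hd, h⟩ := exists_eq_div w
    rw [Submodule.mem_one]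
    refine (mem_range_iff_dvd hd ?_).2 (hy c d hd ((mem_one_div_inK hd h).1 hw))
    rw [mul_assoc, h, map_mul, mul_comm]

theorem isDivisorial_iff {I : Ideal R} : IsDivisorial I ↔ I ≠ ⊥ ∧ vcl I ≤ I := by
  refine and_congr_right fun _ => ⟨fun h y hy => ?_, fun h => ?_⟩
  · rw [← algebraMap_mem_inK, ← h]
    exact mem_one_div_one_div_inK.2 ⟨y, hy, rfl⟩
  · ext z
    rw [mem_one_div_one_div_inK, mem_inK]
    exact exists_congr fun y => and_congr_left fun _ => ⟨fun hy => h hy, fun hy => le_vcl I hy⟩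

theorem isStronglyPrime_iff {P : Ideal R} : IsStronglyPrime P ↔
    ∀ a b c d : R, b ≠ 0 → d ≠ 0 → (∃ p ∈ P, a * c = b * d * p) →
      (∃ p ∈ P, a = b * p) ∨ (∃ p ∈ P, c = d * p) := by
  constructor
  · intro H a b c d hb hd hp
    have hb' : algebraMap R (FractionRing R) b ≠ 0 := by simpa using hb
    have hd' : algebraMap R (FractionRing R) d ≠ 0 := by simpa using hd
    have h1 := div_mul_cancel₀ (algebraMap R (FractionRing R) a) hb'
    have h2 := div_mul_cancel₀ (algebraMap R (FractionRing R) c) hd'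
    have := H _ _ ((mem_inK_iff (mul_ne_zero hb hd) (a := a * c)
      (by rw [map_mul, mul_mul_mul_comm, h1, h2, map_mul])).2 hp)
    rwa [mem_inK_iff hb h1, mem_inK_iff hd h2] at this
  · intro H x y hxy
    obtain ⟨a, b, hb, h1⟩ := exists_eq_div x
    obtain ⟨c, d, hd, h2⟩ := exists_eq_div y
    rw [mem_inK_iff (mul_ne_zero hb hd) (a := a * c)
      (by rw [map_mul, mul_mul_mul_comm, h1, h2, map_mul])] at hxy
    rw [mem_inK_iff hb h1, mem_inK_iff hd h2]
    exact H a b c d hb hd hxy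

theorem isSeminormal_iff :
    IsSeminormal R ↔ ∀ a b : R, b ≠ 0 → b ^ 2 ∣ a ^ 2 → b ^ 3 ∣ a ^ 3 → b ∣ a := by
  constructor
  · intro H a b hb h2 h3
    have hb' : algebraMap R (FractionRing R) b ≠ 0 := by simpa using hb
    have h1 := div_mul_cancel₀ (algebraMap R (FractionRing R) a) hb'
    refine (mem_range_iff_dvd hb h1).1 (H _ ?_ ?_)
    · exact (mem_range_iff_dvd (pow_ne_zero 2 hb) (by rw [map_pow, ← mul_pow, h1, map_pow])).2 h2
    · exact (mem_range_iff_dvd (pow_ne_zero 3 hb) (by rw [map_pow, ← mul_pow, h1, map_pow])).2 h3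
  · intro H x h2 h3
    obtain ⟨a, b, hb, h1⟩ := exists_eq_div x
    refine (mem_range_iff_dvd hb h1).2 (H a b hb ?_ ?_)
    · exact (mem_range_iff_dvd (pow_ne_zero 2 hb) (by rw [map_pow, ← mul_pow, h1, map_pow])).1 h2
    · exact (mem_range_iff_dvd (pow_ne_zero 3 hb) (by rw [map_pow, ← mul_pow, h1, map_pow])).1 h3

end Internal

/-! ### Localization at a prime ideal. -/

section Localization

variable {R : Type*} [CommRing R] (M : Ideal R) [M.IsPrime]

theorem isUnit_algebraMap_of_notMem {s : R} (hs : s ∉ M) :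
    IsUnit (algebraMap R (Localization.AtPrime M) s) :=
  IsLocalization.map_units (Localization.AtPrime M) (⟨s, hs⟩ : M.primeCompl)

theorem exists_eq_algebraMap_mul_unit (a : Localization.AtPrime M) :
    ∃ (r : R) (u : (Localization.AtPrime M)ˣ), a = algebraMap R (Localization.AtPrime M) r * u := by
  obtain ⟨⟨r, s⟩, h⟩ := IsLocalization.surj M.primeCompl a
  refine ⟨r, (isUnit_algebraMap_of_notMem M s.2).unit⁻¹, ?_⟩
  rw [← h, mul_assoc, IsUnit.mul_val_inv, mul_one]

theorem algebraMap_mem_map_iff {I : Ideal R} {x : R} :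
    algebraMap R (Localization.AtPrime M) x ∈ I.map (algebraMap R (Localization.AtPrime M)) ↔
      ∃ s ∉ M, s * x ∈ I := by
  rw [IsLocalization.algebraMap_mem_map_algebraMap_iff M.primeCompl]
  rfl

theorem algebraMap_dvd_iff {c d : R} :
    algebraMap R (Localization.AtPrime M) d ∣ algebraMap R (Localization.AtPrime M) c ↔
      ∃ s ∉ M, d ∣ s * c := by
  have := algebraMap_mem_map_iff M (I := Ideal.span {d}) (x := c)
  simpa [Ideal.map_span, Ideal.mem_span_singleton] using this

theorem map_eq_top_of_notMem {I : Ideal R} {x : R} (hx : x ∈ I) (hM : x ∉ M) :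
    I.map (algebraMap R (Localization.AtPrime M)) = ⊤ :=
  Ideal.eq_top_of_isUnit_mem _ (Ideal.mem_map_of_mem _ hx) (isUnit_algebraMap_of_notMem M hM)

theorem map_comap_localization (A : Ideal (Localization.AtPrime M)) :
    (A.comap (algebraMap R (Localization.AtPrime M))).map (algebraMap R (Localization.AtPrime M)) =
      A :=
  IsLocalization.map_under M.primeCompl _ A

theorem dvd_of_forall_localization {c d : R}
    (h : ∀ (N : Ideal R) [N.IsMaximal], algebraMap R (Localization.AtPrime N) d ∣
      algebraMap R (Localization.AtPrime N) c) : d ∣ c := by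
  rw [← Ideal.mem_span_singleton]
  refine Ideal.mem_of_localization_maximal fun N _ => ?_
  rw [Ideal.map_span, Set.image_singleton, Ideal.mem_span_singleton]
  exact h N

variable [IsDomain R]

theorem algebraMap_localization_injective :
    Function.Injective (algebraMap R (Localization.AtPrime M)) :=
  IsLocalization.injective (Localization.AtPrime M) M.primeCompl_le_nonZeroDivisors

theorem algebraMap_localization_ne_zero {x : R} :
    algebraMap R (Localization.AtPrime M) x ≠ 0 ↔ x ≠ 0 :=
  map_ne_zero_iff _ (algebraMap_localization_injective M)

theorem map_localization_ne_bot {I : Ideal R} (h : I ≠ ⊥) :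
    I.map (algebraMap R (Localization.AtPrime M)) ≠ ⊥ := by
  rwa [Ne, Ideal.map_eq_bot_iff_of_injective (algebraMap_localization_injective M)]

omit [IsDomain R] in
theorem comap_localization_ne_bot {A : Ideal (Localization.AtPrime M)} (h : A ≠ ⊥) :
    A.comap (algebraMap R (Localization.AtPrime M)) ≠ ⊥ := by
  intro h0
  rw [← map_comap_localization M A, h0, Ideal.map_bot] at h
  exact h rfl

end Localization

/-! ### Divisorial ideals and Mori domains. -/

section Mori

variable {R : Type*} [CommRing R] [IsDomain R]

theorem isDivisorial_vcl {I : Ideal R} (h : I ≠ ⊥) : IsDivisorial (vcl I) :=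
  isDivisorial_iff.2 ⟨fun h0 => h (eq_bot_iff.2 (h0 ▸ le_vcl I)), vcl_le_vcl le_rfl⟩

theorem isDivisorial_top : IsDivisorial (⊤ : Ideal R) :=
  isDivisorial_iff.2 ⟨top_ne_bot, le_top⟩

theorem IsDivisorial.inf {I J : Ideal R} (hI : IsDivisorial I) (hJ : IsDivisorial J) :
    IsDivisorial (I ⊓ J) := by
  rw [isDivisorial_iff] at *
  refine ⟨fun h => ?_, le_inf ((vcl_mono inf_le_left).trans hI.2)
    ((vcl_mono inf_le_right).trans hJ.2)⟩
  obtain ⟨x, hx, hx0⟩ := Submodule.exists_mem_ne_zero_of_ne_bot hI.1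
  obtain ⟨y, hy, hy0⟩ := Submodule.exists_mem_ne_zero_of_ne_bot hJ.1
  have : x * y ∈ I ⊓ J := ⟨I.mul_mem_right _ hx, J.mul_mem_left _ hy⟩
  rw [h] at this
  exact mul_ne_zero hx0 hy0 this

theorem IsDivisorial.finset_inf {ι : Type*} {f : ι → Ideal R} (T : Finset ι)
    (h : ∀ i ∈ T, IsDivisorial (f i)) : IsDivisorial (T.inf f) := by
  classical
  induction T using Finset.induction_on with
  | empty => simpa using isDivisorial_top
  | insert a s _ ih =>
    rw [Finset.inf_insert]
    exact (h a (Finset.mem_insert_self _ _)).inf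
      (ih fun i hi => h i (Finset.mem_insert_of_mem hi))

theorem IsDivisorial.span_singleton_mul {t : R} (ht : t ≠ 0) {I : Ideal R}
    (hI : IsDivisorial I) : IsDivisorial (Ideal.span {t} * I) := by
  rw [isDivisorial_iff] at *
  refine ⟨mul_ne_zero (by simpa using ht) hI.1, fun y hy => ?_⟩
  obtain ⟨y', rfl⟩ : t ∣ y := by
    have := hy 1 t ht fun x hx => by
      rw [one_mul]
      exact Ideal.mem_span_singleton.1 (Ideal.mul_le_left hx)
    rwa [one_mul] at this
  refine Ideal.mem_span_singleton_mul.2 ⟨y', hI.2 fun c d hd h => ?_, rfl⟩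
  have := hy c (t * d) (mul_ne_zero ht hd) fun x hx => by
    obtain ⟨z, hz, rfl⟩ := Ideal.mem_span_singleton_mul.1 hx
    rw [mul_left_comm]
    exact mul_dvd_mul_left t (h z hz)
  rw [mul_left_comm] at this
  exact (mul_dvd_mul_iff_left ht).1 this

theorem isDivisorial_span_singleton {t : R} (ht : t ≠ 0) : IsDivisorial (Ideal.span {t}) := by
  simpa using isDivisorial_top.span_singleton_mul ht

omit [IsDomain R] in
theorem IsMori.exists_maximal (hR : IsMori R) {S : Set (Ideal R)} (hS : S.Nonempty)
    (hd : ∀ I ∈ S, IsDivisorial I) : ∃ I ∈ S, ∀ J ∈ S, I ≤ J → J = I := by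
  obtain ⟨I₀, h₀⟩ := hS
  have : WellFoundedGT {I : Ideal R // IsDivisorial I} := hR
  obtain ⟨I, hI, hmax⟩ := this.wf.has_min {I | I.1 ∈ S} ⟨⟨I₀, hd _ h₀⟩, h₀⟩
  refine ⟨I.1, hI, fun J hJ hle => (eq_of_le_of_not_lt hle fun hlt => ?_).symm⟩
  exact hmax ⟨J, hd _ hJ⟩ hJ hlt

omit [IsDomain R] in
theorem isMori_of_exists_maximal (h : ∀ S : Set (Ideal R), S.Nonempty →
    (∀ I ∈ S, IsDivisorial I) → ∃ I ∈ S, ∀ J ∈ S, I ≤ J → J = I) : IsMori R := by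
  refine ⟨WellFounded.wellFounded_iff_has_min.2 fun S hS => ?_⟩
  obtain ⟨I, hI, hmax⟩ := h (Subtype.val '' S) (hS.image _) (by rintro _ ⟨I, -, rfl⟩; exact I.2)
  obtain ⟨I, hI', rfl⟩ := hI
  exact ⟨I, hI', fun J hJ hlt =>
    hlt.ne' (Subtype.ext (hmax J.1 ⟨J, hJ, rfl⟩ (le_of_lt hlt)))⟩

/-- Take `vcl J` maximal over nonzero finitely generated `J ≤ I`; adjoining one more element of `I`
to `J` cannot enlarge it. -/
theorem IsMori.exists_fg_le_vcl (hR : IsMori R) {I : Ideal R} (hI : I ≠ ⊥) :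
    ∃ J : Ideal R, J.FG ∧ J ≤ I ∧ I ≤ vcl J := by
  obtain ⟨x, hx, hx0⟩ := Submodule.exists_mem_ne_zero_of_ne_bot hI
  obtain ⟨_, ⟨J, ⟨hJ, hJ0, hJI⟩, rfl⟩, hmax⟩ := hR.exists_maximal
    (S := vcl '' {J : Ideal R | J.FG ∧ J ≠ ⊥ ∧ J ≤ I})
    ⟨_, Ideal.span {x}, ⟨⟨{x}, by simp⟩, by simpa using hx0, by
      simpa [Ideal.span_le] using hx⟩, rfl⟩
    (by rintro _ ⟨J, hJ, rfl⟩; exact isDivisorial_vcl hJ.2.1)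
  refine ⟨J, hJ, hJI, fun y hy => ?_⟩
  have := hmax (vcl (J ⊔ Ideal.span {y}))
    ⟨_, ⟨Submodule.FG.sup hJ ⟨{y}, by simp⟩, fun h => hJ0 ?_, ?_⟩, rfl⟩
    (vcl_mono le_sup_left)
  · rw [← this]
    exact le_vcl _ ((le_sup_right : _ ≤ J ⊔ Ideal.span {y}) (Ideal.mem_span_singleton_self y))
  · exact eq_bot_iff.2 (h ▸ le_sup_left)
  · exact sup_le hJI (by simpa [Ideal.span_le] using hy)

omit [IsDomain R] in
theorem exists_notMem_forall_dvd (M : Ideal R) [M.IsPrime] {J : Ideal R} (hJ : J.FG) {c d : R}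
    (h : ∀ x ∈ J, algebraMap R (Localization.AtPrime M) d ∣
      algebraMap R (Localization.AtPrime M) (c * x)) :
    ∃ s ∉ M, ∀ x ∈ J, d ∣ s * c * x := by
  classical
  obtain ⟨T, rfl⟩ := hJ
  have : ∀ x ∈ T, ∃ s ∉ M, d ∣ s * (c * x) := fun x hx =>
    (algebraMap_dvd_iff M).1 (h x (Submodule.subset_span hx))
  choose! f hf hf' using this
  refine ⟨∏ x ∈ T, f x, fun hmem => ?_, fun x hx => ?_⟩
  · obtain ⟨x, hx, hx'⟩ := (Ideal.IsPrime.prod_mem_iff (p := M)).1 hmem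
    exact hf x hx hx'
  · rw [← Ideal.mem_span_singleton]
    induction hx using Submodule.span_induction with
    | mem x hx =>
      rw [Ideal.mem_span_singleton, ← Finset.mul_prod_erase T f hx]
      obtain ⟨e, he⟩ := hf' x hx
      exact ⟨e * ∏ x ∈ T.erase x, f x, by linear_combination (∏ x ∈ T.erase x, f x) * he⟩
    | zero => simp
    | add x y _ _ hx hy => rw [mul_add]; exact add_mem hx hy
    | smul r x _ hx => rw [smul_eq_mul, mul_left_comm]; exact Ideal.mul_mem_left _ _ hx

/-- Replace `I` by a finitely generated subideal with the same closure: a single denominator outside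
`M` then serves all its elements. -/
theorem IsMori.algebraMap_mem_vcl_map (hR : IsMori R) (M : Ideal R) [M.IsPrime] {I : Ideal R}
    (hI : I ≠ ⊥) {y : R} (hy : y ∈ vcl I) :
    algebraMap R (Localization.AtPrime M) y ∈
      vcl (I.map (algebraMap R (Localization.AtPrime M))) := by
  obtain ⟨J, hJ, hJI, hIJ⟩ := hR.exists_fg_le_vcl hI
  intro c' d' hd h
  obtain ⟨c, u, rfl⟩ := exists_eq_algebraMap_mul_unit M c'
  obtain ⟨d, v, rfl⟩ := exists_eq_algebraMap_mul_unit M d'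
  have key : ∀ x : R, algebraMap R (Localization.AtPrime M) d * v ∣
      algebraMap R (Localization.AtPrime M) c * u * algebraMap R (Localization.AtPrime M) x ↔
      algebraMap R (Localization.AtPrime M) d ∣
        algebraMap R (Localization.AtPrime M) (c * x) := fun x => by
    rw [Units.mul_right_dvd, mul_right_comm, Units.dvd_mul_right, map_mul]
  have hd0 : d ≠ 0 := by
    rintro rfl
    simp at hd
  obtain ⟨s, hs, H⟩ := exists_notMem_forall_dvd M hJ (c := c) (d := d) fun x hx =>
    (key x).1 (h _ (Ideal.mem_map_of_mem _ (hJI hx)))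
  rw [key, algebraMap_dvd_iff]
  exact ⟨s, hs, mul_assoc s c y ▸ vcl_le_vcl hIJ hy _ _ hd0 H⟩

theorem IsMori.localization (hR : IsMori R) (M : Ideal R) [M.IsPrime] :
    IsMori (Localization.AtPrime M) := by
  have hcomap : ∀ A : Ideal (Localization.AtPrime M), IsDivisorial A →
      IsDivisorial (A.comap (algebraMap R (Localization.AtPrime M))) := fun A hA => by
    rw [isDivisorial_iff] at *
    refine ⟨comap_localization_ne_bot M hA.1, fun y hy => hA.2 ?_⟩
    simpa only [map_comap_localization] using
      hR.algebraMap_mem_vcl_map M (comap_localization_ne_bot M hA.1) hy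
  refine isMori_of_exists_maximal fun S hS hd => ?_
  obtain ⟨_, ⟨I, hI, rfl⟩, hmax⟩ := hR.exists_maximal
    (S := Ideal.comap (algebraMap R (Localization.AtPrime M)) '' S) (hS.image _)
    (by rintro _ ⟨I, hI, rfl⟩; exact hcomap I (hd I hI))
  refine ⟨I, hI, fun J hJ hle => ?_⟩
  rw [← map_comap_localization M J, hmax _ ⟨J, hJ, rfl⟩ (Ideal.comap_mono hle),
    map_comap_localization]

/-- For a divisorial ideal `I` containing `x ≠ 0`, this is the ideal `x (R : I)`. -/
def dualIdeal (x : R) (I : Ideal R) : Ideal R where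
  carrier := {z | ∀ w ∈ I, x ∣ w * z}
  add_mem' := fun ha hb w hw => by rw [mul_add]; exact dvd_add (ha w hw) (hb w hw)
  zero_mem' := fun w _ => by simp
  smul_mem' := fun r y hy w hw => by
    rw [smul_eq_mul, mul_left_comm]; exact (hy w hw).mul_left r

theorem isDivisorial_dualIdeal {x : R} (hx : x ≠ 0) (I : Ideal R) :
    IsDivisorial (dualIdeal x I) := by
  refine isDivisorial_iff.2 ⟨fun h => ?_, fun y hy w hw => hy w x hx fun z hz => hz w hw⟩
  have : x ∈ dualIdeal x I := fun w _ => dvd_mul_left x w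
  rw [h] at this
  exact hx this

/-- If `c / d ∈ R : I`, then `z = x c / d` lies in `x (R : I)`, hence in `x (R : J)`, so `w c / d =
w z / x ∈ R` for each `w ∈ J`. -/
theorem le_of_dualIdeal_le {x : R} (hx : x ≠ 0) {I J : Ideal R} (hI : IsDivisorial I)
    (hxI : x ∈ I) (h : dualIdeal x I ≤ dualIdeal x J) : J ≤ I := by
  refine fun w hw => (isDivisorial_iff.1 hI).2 fun c d hd H => ?_
  obtain ⟨z, hz⟩ := H x hxI
  have hzI : z ∈ dualIdeal x I := fun v hv => by
    obtain ⟨e, he⟩ := H v hv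
    refine ⟨e, mul_left_cancel₀ hd ?_⟩
    linear_combination x * he - v * hz
  obtain ⟨e, he⟩ := h hzI w hw
  refine ⟨e, mul_left_cancel₀ hx ?_⟩
  linear_combination d * he + w * hz

/-- The order-reversing map `I ↦ x (R : I)` turns the ascending chain condition into a descending
one above `x`. -/
theorem IsMori.exists_minimal (hR : IsMori R) {x : R} (hx : x ≠ 0) {S : Set (Ideal R)}
    (hS : S.Nonempty) (hd : ∀ I ∈ S, IsDivisorial I ∧ x ∈ I) :
    ∃ I ∈ S, ∀ J ∈ S, J ≤ I → I ≤ J := by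
  obtain ⟨_, ⟨I, hI, rfl⟩, hmax⟩ := hR.exists_maximal (S := dualIdeal x '' S) (hS.image _)
    (by rintro _ ⟨I, -, rfl⟩; exact isDivisorial_dualIdeal hx I)
  refine ⟨I, hI, fun J hJ hJI => ?_⟩
  refine le_of_dualIdeal_le hx (hd J hJ).1 (hd J hJ).2 (hmax _ ⟨J, hJ, rfl⟩ ?_).le
  exact fun z hz w hw => hz w (hJI hw)

/-- A minimal finite intersection of such ideals lies in every other such `M`, so `M`, being prime,
contains one of its members. -/
theorem IsMori.finite_divisorial_maximal (hR : IsMori R) {x : R} (hx : x ≠ 0) :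
    {M : Ideal R | M.IsMaximal ∧ IsDivisorial M ∧ x ∈ M}.Finite := by
  classical
  obtain ⟨_, ⟨T, hT, rfl⟩, hmin⟩ := hR.exists_minimal hx
    (S := (fun T : Finset (Ideal R) => T.inf id) ''
      {T | ∀ M ∈ T, M.IsMaximal ∧ IsDivisorial M ∧ x ∈ M})
    ⟨_, ∅, by simp, rfl⟩ (by
      rintro _ ⟨T, hT, rfl⟩
      exact ⟨IsDivisorial.finset_inf T fun i hi => (hT i hi).2.1,
        (Submodule.mem_finsetInf).2 fun i hi => (hT i hi).2.2⟩)
  refine T.finite_toSet.subset fun M hM => ?_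
  have hle : T.inf id ≤ M := by
    have := hmin ((insert M T).inf id) ⟨insert M T, by
      intro N hN
      rcases Finset.mem_insert.1 hN with rfl | hN
      exacts [hM, hT N hN], rfl⟩ (by rw [Finset.inf_insert]; exact inf_le_right)
    exact this.trans (Finset.inf_le (f := id) (Finset.mem_insert_self M T))
  obtain ⟨N, hN, hNM⟩ := (Ideal.IsPrime.inf_le' hM.1.isPrime).1 hle
  rwa [← (hT N hN).1.eq_of_le hM.1.ne_top hNM]

/-- If `b ≠ 0`, the principal ideals `(b / aⁿ)` form an ascending chain of divisorial ideals; where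
it stops, `a` is a unit. -/
theorem IsMori.eq_zero_of_forall_pow_dvd (hR : IsMori R) {a b : R} (ha : ¬ IsUnit a)
    (h : ∀ n : ℕ, a ^ n ∣ b) : b = 0 := by
  by_contra hb
  choose f hf using h
  have ha0 : a ≠ 0 := by
    rintro rfl
    exact hb (by simpa using hf 1)
  have hf0 : ∀ n, f n ≠ 0 := fun n h0 => hb (by rw [hf n, h0, mul_zero])
  obtain ⟨_, ⟨n, rfl⟩, hmax⟩ := hR.exists_maximal
    (S := Set.range fun n => Ideal.span {f n}) (Set.range_nonempty _)
    (by rintro _ ⟨n, rfl⟩; exact isDivisorial_span_singleton (hf0 n))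
  have hstep : f n = a * f (n + 1) := by
    refine mul_left_cancel₀ (pow_ne_zero n ha0) ?_
    rw [← hf n, ← mul_assoc, ← pow_succ, ← hf]
  have := hmax _ ⟨n + 1, rfl⟩ (Ideal.span_singleton_le_span_singleton.2 ⟨a, by
    rw [hstep, mul_comm]⟩)
  obtain ⟨e, he⟩ := Ideal.span_singleton_le_span_singleton.1 this.le
  refine ha (IsUnit.of_mul_eq_one e (mul_left_cancel₀ (hf0 (n + 1)) ?_))
  rw [hstep] at he
  linear_combination -he

theorem mem_vcl_of_forall_localization {I : Ideal R} {y : R}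
    (h : ∀ (M : Ideal R) [M.IsMaximal], algebraMap R (Localization.AtPrime M) y ∈
      vcl (I.map (algebraMap R (Localization.AtPrime M)))) : y ∈ vcl I := by
  intro c d hd hc
  refine dvd_of_forall_localization fun M _ => ?_
  rw [map_mul]
  refine h M _ _ ((algebraMap_localization_ne_zero M).2 hd) fun x hx => ?_
  have hle : I.map (algebraMap R (Localization.AtPrime M)) ≤
      (Ideal.span {algebraMap R (Localization.AtPrime M) d}).colon
        {algebraMap R (Localization.AtPrime M) c} := by
    refine Ideal.map_le_iff_le_comap.2 fun z hz => ?_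
    rw [Ideal.mem_comap, Submodule.mem_colon_singleton, Ideal.mem_span_singleton, smul_eq_mul,
      mul_comm, ← map_mul]
    exact map_dvd _ (hc z hz)
  have := hle hx
  rwa [Submodule.mem_colon_singleton, Ideal.mem_span_singleton, smul_eq_mul, mul_comm] at this

omit [IsDomain R] in
theorem finite_maximal_of_hasFiniteCharacter (hR : HasFiniteCharacter R) {x : R} (hx : x ≠ 0) :
    {M : Ideal R | M.IsMaximal ∧ x ∈ M}.Finite := by
  by_cases hu : IsUnit x
  · refine Set.finite_empty.subset fun M hM => ?_
    exact hM.1.ne_top (Ideal.eq_top_of_isUnit_mem _ hM.2 hu)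
  · exact hR x hx hu

theorem isMori_of_hasFiniteCharacter (hfc : HasFiniteCharacter R)
    (hM : ∀ (M : Ideal R) [M.IsMaximal], IsMori (Localization.AtPrime M)) : IsMori R := by
  refine wellFoundedGT_iff_monotone_chain_condition.2 fun f => ?_
  obtain ⟨x, hx, hx0⟩ := Submodule.exists_mem_ne_zero_of_ne_bot (f 0).2.1
  have hxn : ∀ n, x ∈ (f n).1 := fun n => f.mono (Nat.zero_le n) hx
  have hloc : ∀ M : Ideal R, ∃ N, ∀ (_ : M.IsMaximal), ∀ n, N ≤ n →
      vcl ((f n).1.map (algebraMap R (Localization.AtPrime M))) =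
      vcl ((f N).1.map (algebraMap R (Localization.AtPrime M))) := by
    intro M
    by_cases hMm : M.IsMaximal
    · have : WellFoundedGT {I : Ideal (Localization.AtPrime M) // IsDivisorial I} := hM M
      obtain ⟨N, hN⟩ := WellFoundedGT.monotone_chain_condition
        (⟨fun n => ⟨vcl ((f n).1.map (algebraMap R (Localization.AtPrime M))),
          isDivisorial_vcl (map_localization_ne_bot M (f n).2.1)⟩, fun a b hab =>
            vcl_mono (Ideal.map_mono (f.mono hab))⟩ :
          ℕ →o {I : Ideal (Localization.AtPrime M) // IsDivisorial I})
      exact ⟨N, fun _ n hn => (congrArg Subtype.val (hN n hn)).symm⟩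
    · exact ⟨0, fun h => absurd h hMm⟩
  choose N hN using hloc
  -- Only the finitely many maximal ideals containing `x ∈ f 0` matter: at every other one, all `f
  -- n` become the unit ideal.
  refine ⟨(finite_maximal_of_hasFiniteCharacter hfc hx0).toFinset.sup N, fun n hn => ?_⟩
  refine le_antisymm (f.mono hn) fun y hy => (isDivisorial_iff.1 (f _).2).2 ?_
  refine mem_vcl_of_forall_localization fun M _ => ?_
  by_cases hxM : x ∈ M
  · have hle := Finset.le_sup (f := N)
      ((finite_maximal_of_hasFiniteCharacter hfc hx0).mem_toFinset.2 ⟨‹M.IsMaximal›, hxM⟩)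
    rw [hN M ‹_› _ hle, ← hN M ‹_› n (hle.trans hn)]
    exact le_vcl _ (Ideal.mem_map_of_mem _ hy)
  · rw [map_eq_top_of_notMem M (hxn _) hxM]
    exact le_vcl _ trivial

end Mori

open IsLocalRing

/-! ### Local pseudo-valuation domains. -/

section PVD

variable {D : Type*} [CommRing D] [IsDomain D] [IsLocalRing D]

/-- Let `x y ∈ P` with, say, `y ∈ m`. If `x ∈ D`, primality of `P` suffices. If not, strong
primality of `m` applied to `x (y / x) = y` gives `y / x ∈ m`, so `y² = (y / x) (x y) ∈ P`. -/
theorem isPVD_of_isStronglyPrime_maximalIdeal (h : IsStronglyPrime (maximalIdeal D)) :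
    IsPVD D := by
  rw [isStronglyPrime_iff] at h
  intro P hP
  have hPm : P ≤ maximalIdeal D := le_maximalIdeal hP.ne_top
  have aux : ∀ a b c d p q : D, b ≠ 0 → d ≠ 0 → p ∈ P → a * c = b * d * p →
      q ∈ maximalIdeal D → c = d * q → (∃ p ∈ P, a = b * p) ∨ (∃ p ∈ P, c = d * p) := by
    rintro a b _ d p q hb hd hp hac hq rfl
    have haq : a * q = b * p := mul_left_cancel₀ hd (by linear_combination hac)
    by_cases hba : b ∣ a
    · obtain ⟨e, rfl⟩ := hba
      have : e * q = p := mul_left_cancel₀ hb (by linear_combination haq)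
      rcases hP.mem_or_mem (this ▸ hp) with he | hq'
      exacts [Or.inl ⟨e, he, rfl⟩, Or.inr ⟨q, hq', rfl⟩]
    · have ha : a ≠ 0 := by
        rintro rfl
        exact hba (dvd_zero b)
      rcases h a b (b * q) a hb ha ⟨q, hq, by ring⟩ with ⟨r, -, hr⟩ | ⟨r, -, hr⟩
      · exact absurd ⟨r, hr⟩ hba
      · have hq2 : q * q = r * p :=
          mul_left_cancel₀ hb (by linear_combination q * hr + r * haq)
        have : q * q ∈ P := hq2 ▸ P.mul_mem_left r hp
        exact Or.inr ⟨q, (hP.mem_or_mem this).elim id id, rfl⟩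
  rw [isStronglyPrime_iff]
  rintro a b c d hb hd ⟨p, hp, hac⟩
  rcases h a b c d hb hd ⟨p, hPm hp, hac⟩ with ⟨q, hq, hq'⟩ | ⟨q, hq, hq'⟩
  · exact (aux c d a b p q hd hb hp (by linear_combination hac) hq hq').symm
  · exact aux a b c d p q hb hd hp hac hq hq'

theorem IsPVD.dvd_of_sq_cube (hD : IsPVD D) {a b : D} (hb : b ≠ 0) (h2 : b ^ 2 ∣ a ^ 2)
    (h3 : b ^ 3 ∣ a ^ 3) : b ∣ a := by
  obtain ⟨e, he⟩ := h2
  obtain ⟨f, hf⟩ := h3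
  have hae : a * e = b * f :=
    mul_left_cancel₀ (pow_ne_zero 2 hb) (by linear_combination hf - a * he)
  by_cases hu : IsUnit e
  · exact hu.dvd_mul_right.1 ⟨f, hae⟩
  · have := isStronglyPrime_iff.1 (hD (maximalIdeal D) inferInstance) a b a b hb hb
      ⟨e, hu, by linear_combination he⟩
    rw [or_self] at this
    obtain ⟨p, -, hp⟩ := this
    exact ⟨p, hp⟩

/-- Strong primality of `m` applied to `(x a / y) (y / x) = a`; this is the form in which the PVD
property is used below. -/
theorem IsPVD.dichotomy (hD : IsPVD D) {x y a : D} (hx : x ≠ 0) (hy : y ≠ 0)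
    (ha : a ∈ maximalIdeal D) :
    (∃ p ∈ maximalIdeal D, x * a = y * p) ∨ ∃ p ∈ maximalIdeal D, y = x * p :=
  isStronglyPrime_iff.1 (hD _ inferInstance) (x * a) y y x hy hx ⟨a, ha, by ring⟩

theorem IsPVD.exists_dvd_pow (hD : IsPVD D) (hM : IsMori D) {a b : D} (ha : a ∈ maximalIdeal D)
    (hb : b ≠ 0) : ∃ n : ℕ, b ∣ a ^ n := by
  by_cases ha0 : a = 0
  · exact ⟨1, by simp [ha0]⟩
  have : ∃ n : ℕ, ¬ a ^ n ∣ b := by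
    by_contra! h
    exact hb (hM.eq_zero_of_forall_pow_dvd ha h)
  obtain ⟨n, hn⟩ := this
  rcases hD.dichotomy (pow_ne_zero n ha0) hb ha with ⟨p, -, hp⟩ | ⟨p, -, hp⟩
  · exact ⟨n + 1, p, by rw [pow_succ, hp]⟩
  · exact absurd ⟨p, hp⟩ hn

/-- Any nonzero `a ∈ m` works. If `y ∈ T` had `a y ∉ D`, then `1 / y ∈ m` by the dichotomy; every
nonzero `f` divides a power of `1 / y`, so `1 / f ∈ D[y] ⊆ T` and `T` is the whole field. -/
theorem IsPVD.isConducive (hD : IsPVD D) (hM : IsMori D) : IsConducive D := by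
  intro T hT
  by_cases hm : maximalIdeal D = ⊥
  · refine ⟨1, one_mem _, fun y _ => ?_⟩
    obtain ⟨a, b, hb, h⟩ := exists_eq_div y
    have hbu : IsUnit b := by
      by_contra hbu
      exact hb (by simpa [hm] using (mem_maximalIdeal b).2 hbu)
    rw [one_smul]
    exact (mem_range_iff_dvd hb h).2 hbu.dvd
  obtain ⟨a, ha, ha0⟩ := Submodule.exists_mem_ne_zero_of_ne_bot hm
  refine ⟨a, mem_nonZeroDivisors_of_ne_zero ha0, fun y hy => ?_⟩
  obtain ⟨c, d, hd, hyd⟩ := exists_eq_div y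
  refine (mem_range_iff_dvd (a := c * a) hd ?_).2 ?_
  · rw [Algebra.smul_def, mul_assoc, hyd, map_mul, mul_comm]
  by_contra hdvd
  have hc : c ≠ 0 := by
    rintro rfl
    simp at hdvd
  rcases hD.dichotomy hc hd ha with ⟨p, -, hp⟩ | ⟨p, hpm, hp⟩
  · exact hdvd ⟨p, hp⟩
  have hc' : algebraMap D (FractionRing D) c ≠ 0 := by simpa using hc
  have hyp : y * algebraMap D (FractionRing D) p = 1 := by
    have hp' := congrArg (algebraMap D (FractionRing D)) hp
    rw [map_mul] at hp'
    refine mul_left_cancel₀ hc' ?_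
    linear_combination hyd - y * hp'
  refine hT (eq_top_iff.2 fun z _ => ?_)
  obtain ⟨e, f, hf, hzf⟩ := exists_eq_div z
  obtain ⟨n, g, hg⟩ := hD.exists_dvd_pow hM hpm hf
  have hz : z = algebraMap D (FractionRing D) (e * g) * y ^ n := by
    have h1 : (y * algebraMap D (FractionRing D) p) ^ n = 1 := by rw [hyp, one_pow]
    rw [mul_pow, ← map_pow, hg, map_mul] at h1
    rw [map_mul, ← hzf]
    linear_combination -z * h1
  rw [hz]
  exact T.mul_mem (T.algebraMap_mem _) (T.pow_mem hy n)

/-- Otherwise `D : m = D`. Take `(x)` maximal among nonzero proper principal ideals. For `y ∈ m` the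
dichotomy gives `(y / x) m ⊆ D`, so `x ∣ y`. Hence `m ⊆ (x)`, so `1 / x ∈ D : m = D`, which is
absurd. -/
theorem IsPVD.isDivisorial_maximalIdeal (hD : IsPVD D) (hM : IsMori D)
    (hm : maximalIdeal D ≠ ⊥) : IsDivisorial (maximalIdeal D) := by
  refine isDivisorial_iff.2 ⟨hm, ?_⟩
  by_contra hle
  have htop : ∀ c d : D, d ≠ 0 → (∀ x ∈ maximalIdeal D, d ∣ c * x) → d ∣ c := by
    intro c d hd h
    obtain ⟨u, hu, hum⟩ := SetLike.not_le_iff_exists.1 hle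
    exact (notMem_maximalIdeal.1 hum).dvd_mul_right.1 (hu c d hd h)
  obtain ⟨x₀, hx₀, hx₀0⟩ := Submodule.exists_mem_ne_zero_of_ne_bot hm
  obtain ⟨_, ⟨x, ⟨hx, hx0⟩, rfl⟩, hmax⟩ := hM.exists_maximal
    (S := (fun x => Ideal.span {x}) '' {x | x ∈ maximalIdeal D ∧ x ≠ 0})
    ⟨_, x₀, ⟨hx₀, hx₀0⟩, rfl⟩ (by
      rintro _ ⟨x, hx, rfl⟩
      exact isDivisorial_span_singleton hx.2)
  have hdvd : ∀ y ∈ maximalIdeal D, x ∣ y := by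
    intro y hy
    by_cases hy0 : y = 0
    · simp [hy0]
    refine htop y x hx0 fun a ha => ?_
    rcases hD.dichotomy hy0 hx0 ha with ⟨p, -, hp⟩ | ⟨p, -, hp⟩
    · exact ⟨p, hp⟩
    · have := hmax _ ⟨y, ⟨hy, hy0⟩, rfl⟩ (Ideal.span_singleton_le_span_singleton.2 ⟨p, hp⟩)
      exact (Ideal.span_singleton_le_span_singleton.1 this.le).mul_right a
  exact hx (isUnit_iff_dvd_one.2 (htop 1 x hx0 fun y hy => by simpa using hdvd y hy))

/-- Take `t m` maximal among the divisorial ideals `y m`, `0 ≠ y ∈ m`. If some `y a` with `y, a ∈ m`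
were outside `t m`, then `t ∈ y m` by the dichotomy, so `y m = t m` by maximality and `t ∈ t m`. -/
theorem IsPVD.exists_uniformizer (hD : IsPVD D) (hM : IsMori D) (hm : maximalIdeal D ≠ ⊥) :
    ∃ t ∈ maximalIdeal D, t ≠ 0 ∧
      maximalIdeal D * maximalIdeal D ≤ Ideal.span {t} * maximalIdeal D := by
  obtain ⟨x₀, hx₀, hx₀0⟩ := Submodule.exists_mem_ne_zero_of_ne_bot hm
  obtain ⟨_, ⟨t, ⟨ht, ht0⟩, rfl⟩, hmax⟩ := hM.exists_maximal
    (S := (fun x => Ideal.span {x} * maximalIdeal D) '' {x | x ∈ maximalIdeal D ∧ x ≠ 0})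
    ⟨_, x₀, ⟨hx₀, hx₀0⟩, rfl⟩ (by
      rintro _ ⟨x, hx, rfl⟩
      exact (hD.isDivisorial_maximalIdeal hM hm).span_singleton_mul hx.2)
  refine ⟨t, ht, ht0, Ideal.mul_le.2 fun y hy a ha => ?_⟩
  by_cases hy0 : y = 0
  · simp [hy0]
  rcases hD.dichotomy hy0 ht0 ha with ⟨p, hpm, hp⟩ | ⟨p, hpm, hp⟩
  · exact Ideal.mem_span_singleton_mul.2 ⟨p, hpm, hp.symm⟩
  · have heq : Ideal.span {y} * maximalIdeal D = Ideal.span {t} * maximalIdeal D :=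
      hmax _ ⟨y, ⟨hy, hy0⟩, rfl⟩
        (Ideal.mul_mono_left (Ideal.span_singleton_le_span_singleton.2 ⟨p, hp⟩))
    have hyp : y * p ∈ Ideal.span {t} * maximalIdeal D :=
      heq ▸ Ideal.mem_span_singleton_mul.2 ⟨p, hpm, rfl⟩
    obtain ⟨q, hq, hqe⟩ := Ideal.mem_span_singleton_mul.1 hyp
    have : q = 1 := mul_left_cancel₀ ht0 (by rw [hqe, mul_one, hp])
    exact absurd (this ▸ hq) ((Ideal.ne_top_iff_one _).1 (maximalIdeal.isMaximal D).ne_top)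

omit [IsDomain D] in
theorem isTwoAbsorbing_of_sq_maximalIdeal_le {J : Ideal D}
    (hJ : maximalIdeal D * maximalIdeal D ≤ J) : IsTwoAbsorbing J := by
  intro a b c h
  by_cases ha : IsUnit a
  · exact Or.inr (Or.inr ((Ideal.unit_mul_mem_iff_mem J ha).1 (by rwa [← mul_assoc])))
  by_cases hb : IsUnit b
  · exact Or.inr (Or.inl ((Ideal.unit_mul_mem_iff_mem J hb).1 (by
      rwa [← mul_assoc, mul_comm b a])))
  · exact Or.inl (hJ (Ideal.mul_mem_mul ha hb))

theorem IsPVD.exists_prod_eq (hD : IsPVD D) (hM : IsMori D) {I : Ideal D} (hI : I ≠ ⊥)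
    (hI' : I ≠ ⊤) : ∃ s : Multiset (Ideal D),
      (∀ J ∈ s, maximalIdeal D * maximalIdeal D ≤ J) ∧ s.prod = I := by
  have hIm := le_maximalIdeal hI'
  obtain ⟨t, ht, ht0, hmt⟩ := hD.exists_uniformizer hM fun h => hI (eq_bot_iff.2 (h ▸ hIm))
  obtain ⟨x, hx, hx0⟩ := Submodule.exists_mem_ne_zero_of_ne_bot hI
  have : ∃ n : ℕ, ¬ t ^ n ∣ x := by
    by_contra! h
    exact hx0 (hM.eq_zero_of_forall_pow_dvd ht h)
  obtain ⟨n, hn⟩ := this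
  clear hI hI' hx0
  induction n generalizing I x with
  | zero => simp at hn
  | succ n ih =>
    -- Testing against `t m` rather than `(t)` keeps `I / t` inside `m`. The division stops because
    -- `tⁿ ∤ x`; then some `j ∈ I` is outside `t m`, and the dichotomy gives `m² ⊆ t m ⊆ (j) ⊆ I`.
    by_cases hle : I ≤ Ideal.span {t} * maximalIdeal D
    · let I' : Ideal D := Submodule.comap (LinearMap.mulLeft D t) I
      have hII' : Ideal.span {t} * I' = I := by
        refine le_antisymm (Ideal.span_singleton_mul_le_iff.2 fun z hz => hz) fun y hy => ?_
        obtain ⟨z, -, rfl⟩ := Ideal.mem_span_singleton_mul.1 (hle hy)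
        exact Ideal.mem_span_singleton_mul.2 ⟨z, hy, rfl⟩
      have hI'm : I' ≤ maximalIdeal D := fun y hy => by
        obtain ⟨z, hz, h⟩ := Ideal.mem_span_singleton_mul.1 (hle hy)
        rwa [← mul_left_cancel₀ ht0 h]
      obtain ⟨x', hx', rfl⟩ := Ideal.mem_span_singleton_mul.1 (hle hx)
      obtain ⟨s, hs, hsI⟩ := ih hI'm x' hx fun h =>
        hn (by rw [pow_succ']; exact mul_dvd_mul_left t h)
      refine ⟨Ideal.span {t} ::ₘ s, fun J hJ => ?_, by rw [Multiset.prod_cons, hsI, hII']⟩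
      rcases Multiset.mem_cons.1 hJ with rfl | hJ
      exacts [hmt.trans Ideal.mul_le_left, hs J hJ]
    · refine ⟨{I}, fun J hJ => ?_, by simp⟩
      rw [Multiset.mem_singleton.1 hJ]
      obtain ⟨j, hj, hjt⟩ := SetLike.not_le_iff_exists.1 hle
      have hj0 : j ≠ 0 := by
        rintro rfl
        exact hjt (zero_mem _)
      refine hmt.trans (Ideal.span_singleton_mul_le_iff.2 fun a ha => ?_)
      rcases hD.dichotomy ht0 hj0 ha with ⟨p, -, hp⟩ | ⟨p, hpm, hp⟩
      · exact hp ▸ I.mul_mem_right p hj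
      · exact absurd (Ideal.mem_span_singleton_mul.2 ⟨p, hpm, hp.symm⟩) hjt

/-- A seminormal conducive Mori local domain is a pseudo-valuation domain: its maximal ideal is
the conductor of a valuation overring. -/
theorem IsSeminormal.isPVD (hS : IsSeminormal D) (hM : IsMori D) (hC : IsConducive D) :
    IsPVD D := by
  refine isPVD_of_isStronglyPrime_maximalIdeal ?_
  by_cases hm : maximalIdeal D = ⊥
  · intro x y hxy
    simpa [hm, inK] using hxy
  -- `A` is a valuation ring of the quotient field dominating `D`; it is not the whole field because
  -- `D` is not one.
  obtain ⟨A, hA, hloc⟩ := exists_factor_valuationRing (algebraMap D (FractionRing D))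
  let T : Subalgebra D (FractionRing D) := { A.toSubring with algebraMap_mem' := hA }
  have hT : T ≠ ⊤ := by
    obtain ⟨a, ha, ha0⟩ := Submodule.exists_mem_ne_zero_of_ne_bot hm
    have ha0' : algebraMap D (FractionRing D) a ≠ 0 := by simpa using ha0
    intro htop
    have hinv : (algebraMap D (FractionRing D) a)⁻¹ ∈ A := by
      have : (algebraMap D (FractionRing D) a)⁻¹ ∈ T := htop ▸ Algebra.mem_top
      exact this
    refine ha (hloc.map_nonunit a (IsUnit.of_mul_eq_one ⟨_, hinv⟩ (Subtype.ext ?_)))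
    exact mul_inv_cancel₀ ha0'
  obtain ⟨e, he, heT⟩ := hC T hT
  have he0 : e ≠ 0 := nonZeroDivisors.ne_zero he
  -- The conductor `D : A`, an ideal of `A` contained in `D`.
  let C : FractionRing D → Prop :=
    fun z => ∀ v ∈ A, v * z ∈ (algebraMap D (FractionRing D)).range
  have hCe : C (algebraMap D (FractionRing D) e) := fun v hv => by
    have := heT v hv
    rwa [Algebra.smul_def, mul_comm] at this
  have hCmul : ∀ {v z}, v ∈ A → C z → C (v * z) := fun {v z} hv hz w hw => by
    rw [← mul_assoc]
    exact hz _ (A.mul_mem _ _ hw hv)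
  have hCrange : ∀ {z}, C z → z ∈ (algebraMap D (FractionRing D)).range := fun {z} hz => by
    simpa using hz 1 A.one_mem
  -- Seminormality applied to `v z`, whose square and cube lie in `A z² ⊆ D`, makes the conductor
  -- radical. A radical ideal of a valuation ring is prime: if `x / y ∈ A`, then `x² = (x / y) (x
  -- y)`.
  have hCrad : ∀ {z}, z ∈ A → C (z * z) → C z := fun {z} hz h v hv => by
    refine hS _ ?_ ?_
    · convert h (v ^ 2) (pow_mem hv 2) using 1
      ring
    · convert h (v ^ 3 * z) (A.mul_mem _ _ (pow_mem hv 3) hz) using 1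
      ring
  have hCprime : ∀ {x y}, x ∈ A → y ∈ A → C (x * y) → C x ∨ C y := fun {x y} hx hy h => by
    by_cases hy0 : y = 0
    · exact Or.inr fun v _ => by simp [hy0]
    by_cases hx0 : x = 0
    · exact Or.inl fun v _ => by simp [hx0]
    rcases A.mem_or_inv_mem (x / y) with hv | hv
    · left
      refine hCrad hx ?_
      convert hCmul hv h using 1
      field_simp
    · right
      refine hCrad hy ?_
      convert hCmul hv h using 1
      field_simp
  have hCm : ∀ a ∈ maximalIdeal D, C (algebraMap D (FractionRing D) a) := by
    intro a ha
    by_contra hCa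
    -- If `a ∉ C`, each `r ∈ C` has `r / a ∈ A`, and primality puts `r / a` in `C ⊆ D`. Starting
    -- from `e`, division by `a` never stops.
    have hdiv : ∀ n : ℕ, ∃ r, e = a ^ n * r ∧ C (algebraMap D (FractionRing D) r) := by
      intro n
      induction n with
      | zero => exact ⟨e, by simp, hCe⟩
      | succ n ih =>
        obtain ⟨r, hr, hCr⟩ := ih
        have ha0 : a ≠ 0 := by
          rintro rfl
          exact hCa fun v _ => by simp
        have hr0 : r ≠ 0 := by
          rintro rfl
          exact he0 (by simp [hr])
        have ha0' : algebraMap D (FractionRing D) a ≠ 0 := by simpa using ha0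
        have hr0' : algebraMap D (FractionRing D) r ≠ 0 := by simpa using hr0
        rcases A.mem_or_inv_mem
          (algebraMap D (FractionRing D) r / algebraMap D (FractionRing D) a) with hw | hw
        · have hprod : C (algebraMap D (FractionRing D) a *
              (algebraMap D (FractionRing D) r / algebraMap D (FractionRing D) a)) := by
            rwa [mul_div_cancel₀ _ ha0']
          have hCw := (hCprime (hA a) hw hprod).resolve_left hCa
          obtain ⟨r', hr'⟩ := hCrange hCw
          refine ⟨r', ?_, hr' ▸ hCw⟩
          have : r = a * r' := by
            refine algebraMap_fractionRing_injective ?_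
            rw [map_mul, hr', mul_div_cancel₀ _ ha0']
          rw [hr, this, pow_succ, mul_assoc]
        · refine absurd ?_ hCa
          convert hCmul hw hCr using 1
          field_simp
    exact he0 (hM.eq_zero_of_forall_pow_dvd ha fun n => (hdiv n).imp fun r hr => hr.1)
  have hlast : ∀ x y : FractionRing D, x * y ∈ inK (maximalIdeal D) →
      x ∈ (algebraMap D (FractionRing D)).range →
      x ∈ inK (maximalIdeal D) ∨ y ∈ inK (maximalIdeal D) := by
    rintro _ y hxy ⟨r, rfl⟩
    by_cases hr : IsUnit r
    · right
      obtain ⟨u, rfl⟩ := hr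
      obtain ⟨p, hp, hpy⟩ := mem_inK.1 hxy
      refine mem_inK.2 ⟨(u⁻¹ : Dˣ) * p, Ideal.mul_mem_left _ _ hp, ?_⟩
      rw [map_mul, hpy, ← mul_assoc, ← map_mul, Units.inv_mul, map_one, one_mul]
    · exact Or.inl (mem_inK.2 ⟨r, hr, rfl⟩)
  -- Here `1 / x ∈ A`, so `y = (1 / x) (x y)` stays in the conductor.
  have hout : ∀ x y : FractionRing D, x * y ∈ inK (maximalIdeal D) → x ∉ A →
      y ∈ (algebraMap D (FractionRing D)).range := by
    intro x y hxy hx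
    obtain ⟨p, hp, hpy⟩ := mem_inK.1 hxy
    have hx0 : x ≠ 0 := by
      rintro rfl
      exact hx A.zero_mem
    refine hCrange ?_
    convert hCmul ((A.mem_or_inv_mem x).resolve_left hx) (hpy ▸ hCm p hp) using 1
    field_simp
  intro x y hxy
  by_cases hx : x ∈ A
  · by_cases hy : y ∈ A
    · obtain ⟨p, hp, hpy⟩ := mem_inK.1 hxy
      rcases hCprime hx hy (hpy ▸ hCm p hp) with h | h
      · exact hlast x y hxy (hCrange h)
      · exact (hlast y x (by rwa [mul_comm]) (hCrange h)).symm
    · exact hlast x y hxy (hout y x (by rwa [mul_comm]) hy)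
  · exact (hlast y x (by rwa [mul_comm]) (hout x y hxy hx)).symm

end PVD

/-! ### Seminormality and finite character. -/

section Seminormal

variable {R : Type*} [CommRing R] [IsDomain R]

theorem isSeminormal_of_isLPVD (h : IsLPVD R) : IsSeminormal R := by
  refine isSeminormal_iff.2 fun a b hb h2 h3 => dvd_of_forall_localization fun M _ => ?_
  refine (h M).dvd_of_sq_cube ((algebraMap_localization_ne_zero M).2 hb) ?_ ?_
  · simpa only [map_pow] using map_dvd (algebraMap R (Localization.AtPrime M)) h2
  · simpa only [map_pow] using map_dvd (algebraMap R (Localization.AtPrime M)) h3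

theorem IsSeminormal.localization (h : IsSeminormal R) (M : Ideal R) [M.IsPrime] :
    IsSeminormal (Localization.AtPrime M) := by
  rw [isSeminormal_iff] at *
  intro a' b' hb h2 h3
  obtain ⟨a, u, rfl⟩ := exists_eq_algebraMap_mul_unit M a'
  obtain ⟨b, v, rfl⟩ := exists_eq_algebraMap_mul_unit M b'
  rw [mul_pow, mul_pow, ← Units.val_pow_eq_pow_val, ← Units.val_pow_eq_pow_val,
    Units.mul_right_dvd, Units.dvd_mul_right, ← map_pow, ← map_pow, algebraMap_dvd_iff] at h2 h3
  rw [Units.mul_right_dvd, Units.dvd_mul_right, algebraMap_dvd_iff]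
  obtain ⟨s, hs, hs'⟩ := h2
  obtain ⟨t, ht, ht'⟩ := h3
  have hb0 : b ≠ 0 := by
    rintro rfl
    simp at hb
  -- With `x = a / b`, both `s x²` and `t x³` lie in `R`, hence so do the square and the cube of `s
  -- t x`.
  refine ⟨s * t, fun hst => (Ideal.IsPrime.mem_or_mem ‹_› hst).elim hs ht, h _ b hb0 ?_ ?_⟩
  · exact (hs'.mul_left (s * t ^ 2)).trans (dvd_of_eq (by ring))
  · exact (ht'.mul_left (s ^ 3 * t ^ 2)).trans (dvd_of_eq (by ring))

/-- A nonzero `M` is divisorial because its localization is, and closures pass to localizations; so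
the finiteness for divisorial maximal ideals applies. -/
theorem IsMori.hasFiniteCharacter (hR : IsMori R) (h : IsLPVD R) : HasFiniteCharacter R := by
  intro x hx _
  refine (hR.finite_divisorial_maximal hx).subset fun M ⟨hM, hxM⟩ => ⟨hM, ?_, hxM⟩
  have hM0 : M ≠ ⊥ := fun h0 => hx (by simpa [h0] using hxM)
  refine isDivisorial_iff.2 ⟨hM0, ?_⟩
  by_contra hle
  obtain ⟨u, hu, huM⟩ := SetLike.not_le_iff_exists.1 hle
  have hmap : M.map (algebraMap R (Localization.AtPrime M)) =
      maximalIdeal (Localization.AtPrime M) := Localization.AtPrime.map_eq_maximalIdeal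
  have hdiv := (h M).isDivisorial_maximalIdeal (hR.localization M)
    (hmap ▸ map_localization_ne_bot M hM0)
  have := (isDivisorial_iff.1 hdiv).2 (hmap ▸ hR.algebraMap_mem_vcl_map M hM0 hu)
  exact this (isUnit_algebraMap_of_notMem M huM)

end Seminormal

open IsLocalRing

/-! ### 2-absorbing ideals and their minimal primes. -/

section TwoAbsorbing

variable {R : Type*} [CommRing R]

theorem IsTwoAbsorbing.mul_self_mem {J : Ideal R} (hJ : IsTwoAbsorbing J) {x : R}
    (hx : x ∈ J.radical) : x * x ∈ J := by
  obtain ⟨n, hn⟩ := hx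
  induction n with
  | zero => exact (J.eq_top_iff_one.2 (by simpa using hn)) ▸ trivial
  | succ n ih =>
    cases n with
    | zero => exact J.mul_mem_left _ (by simpa using hn)
    | succ n =>
      rcases hJ x x (x ^ n) (by convert hn using 1; ring) with h | h | h
      · exact h
      · exact ih (by rwa [pow_succ'])
      · exact ih (by rwa [pow_succ'])

/-- Otherwise some prime over `J` avoids both `x` and the complement of `P`, contradicting
minimality. -/
theorem exists_mul_pow_mem_of_mem_minimalPrimes {J P : Ideal R} (hP : P ∈ J.minimalPrimes)
    {x : R} (hx : x ∈ P) : ∃ s ∉ P, ∃ n : ℕ, s * x ^ n ∈ J := by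
  have := hP.1.1
  by_contra! H
  have hdisj : Disjoint (J : Set R) (P.primeCompl ⊔ Submonoid.powers x : Submonoid R) := by
    rw [Set.disjoint_left]
    intro z hz hz'
    obtain ⟨s, hs, _, ⟨n, rfl⟩, rfl⟩ := Submonoid.mem_sup.1 hz'
    exact H s hs n hz
  obtain ⟨Q, hQ, hJQ, hQd⟩ := Ideal.exists_le_prime_disjoint J _ hdisj
  have hQP : Q ≤ P := fun z hz => by
    by_contra hzP
    exact Set.disjoint_left.1 hQd hz
      ((le_sup_left : P.primeCompl ≤ P.primeCompl ⊔ Submonoid.powers x) hzP)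
  have hPQ : P ≤ Q := hP.2 ⟨hQ, hJQ⟩ hQP
  exact Set.disjoint_left.1 hQd (hPQ hx)
    ((le_sup_right : Submonoid.powers x ≤ P.primeCompl ⊔ Submonoid.powers x)
      (Submonoid.mem_powers x))

theorem IsTwoAbsorbing.exists_mul_mem {J P Q : Ideal R} (hJ : IsTwoAbsorbing J)
    (hP : P ∈ J.minimalPrimes) (hQ : Q.IsPrime) (hJQ : J ≤ Q) {x : R} (hx : x ∈ P)
    (hxQ : x ∉ Q) : ∃ s ∉ P, s * x ∈ J := by
  obtain ⟨s, hs, n, hn⟩ := exists_mul_pow_mem_of_mem_minimalPrimes hP hx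
  refine ⟨s, hs, ?_⟩
  induction n with
  | zero => exact J.mul_mem_right _ (by simpa using hn)
  | succ n ih =>
    rcases hJ s (x ^ n) x (by rwa [mul_assoc, ← pow_succ]) with h | h | h
    · exact ih h
    · exact h
    · rw [← pow_succ] at h
      exact absurd (hQ.mem_of_pow_mem _ (hJQ h)) hxQ

theorem IsTwoAbsorbing.mul_le_of_ne {J P Q : Ideal R} (hJ : IsTwoAbsorbing J)
    (hP : P ∈ J.minimalPrimes) (hQ : Q ∈ J.minimalPrimes) (hPQ : P ≠ Q) : P * Q ≤ J := by
  have hPp := hP.1.1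
  have hQp := hQ.1.1
  obtain ⟨x₁, hx₁, hx₁Q⟩ := SetLike.not_le_iff_exists.1
    fun h => hPQ (le_antisymm h (hQ.2 hP.1 h))
  obtain ⟨y₁, hy₁, hy₁P⟩ := SetLike.not_le_iff_exists.1
    fun h => hPQ (le_antisymm (hP.2 hQ.1 h) h)
  -- With `s x, t y ∈ J`, the element `s + t` avoids both primes while `(s + t) x y ∈ J`, so
  -- 2-absorption leaves only `x y ∈ J`. Elements of `P ∩ Q` are then reached by adding `x₁` or
  -- `y₁`.
  have hmain : ∀ x ∈ P, x ∉ Q → ∀ y ∈ Q, y ∉ P → x * y ∈ J := by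
    intro x hx hxQ y hy hyP
    obtain ⟨s, hs, hsx⟩ := hJ.exists_mul_mem hP hQp hQ.1.2 hx hxQ
    obtain ⟨t, ht, hty⟩ := hJ.exists_mul_mem hQ hPp hP.1.2 hy hyP
    have hsQ : s ∈ Q := (hQp.mem_or_mem (hQ.1.2 hsx)).resolve_right hxQ
    have htP : t ∈ P := (hPp.mem_or_mem (hP.1.2 hty)).resolve_right hyP
    have hsum : (s + t) * x * y ∈ J := by
      have : (s + t) * x * y = s * x * y + x * (t * y) := by ring
      rw [this]
      exact J.add_mem (J.mul_mem_right _ hsx) (J.mul_mem_left _ hty)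
    have hstQ : s + t ∉ Q := fun h => ht ((Q.add_mem_iff_right hsQ).1 h)
    have hstP : s + t ∉ P := fun h => hs ((P.add_mem_iff_left htP).1 h)
    rcases hJ _ _ _ hsum with h | h | h
    · exact ((hQp.mem_or_mem (hQ.1.2 h)).elim hstQ hxQ).elim
    · exact ((hPp.mem_or_mem (hP.1.2 h)).elim hstP hyP).elim
    · exact h
  have hleft : ∀ x ∈ P, ∀ y ∈ Q, y ∉ P → x * y ∈ J := by
    intro x hx y hy hyP
    by_cases hxQ : x ∈ Q
    · have h1 := hmain _ (P.add_mem hx hx₁) (fun h => hx₁Q ((Q.add_mem_iff_right hxQ).1 h)) y hy hyP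
      rw [add_mul] at h1
      exact (J.add_mem_iff_left (hmain x₁ hx₁ hx₁Q y hy hyP)).1 h1
    · exact hmain x hx hxQ y hy hyP
  refine Ideal.mul_le.2 fun x hx y hy => ?_
  by_cases hyP : y ∈ P
  · have h1 := hleft x hx _ (Q.add_mem hy hy₁) fun h => hy₁P ((P.add_mem_iff_right hyP).1 h)
    rw [mul_add] at h1
    exact (J.add_mem_iff_left (hleft x hx y₁ hy₁ hy₁P)).1 h1
  · exact hleft x hx y hy hyP

theorem IsTwoAbsorbing.exists_mul_le {J P : Ideal R} (hJ : IsTwoAbsorbing J)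
    (hP : P ∈ J.minimalPrimes) :
    P * P ≤ J ∨ ∃ Q ∈ J.minimalPrimes, Q ≠ P ∧ P * Q ≤ J := by
  by_cases h : ∃ Q ∈ J.minimalPrimes, Q ≠ P
  · obtain ⟨Q, hQ, hne⟩ := h
    exact Or.inr ⟨Q, hQ, hne, hJ.mul_le_of_ne hP hQ hne.symm⟩
  · left
    push Not at h
    have hrad : J.radical = P := by
      rw [← Ideal.sInf_minimalPrimes, Set.eq_singleton_iff_unique_mem.2 ⟨hP, h⟩, sInf_singleton]
    refine Ideal.mul_le.2 fun x hx y hy => ?_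
    have hx2 : x * x ∈ J := hJ.mul_self_mem (hrad ▸ hx)
    have hy2 : y * y ∈ J := hJ.mul_self_mem (hrad ▸ hy)
    -- Polarization: squares of elements of `P` lie in `J`, and each outcome of 2-absorption gives
    -- `x y ∈ J`.
    have : x * y * (x + y) ∈ J := by
      have : x * y * (x + y) = y * (x * x) + x * (y * y) := by ring
      rw [this]
      exact J.add_mem (J.mul_mem_left _ hx2) (J.mul_mem_left _ hy2)
    rcases hJ _ _ _ this with h | h | h
    · exact h
    · rw [mul_add] at h
      exact (J.add_mem_iff_right hx2).1 h
    · rw [mul_add, mul_comm y x] at h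
      exact (J.add_mem_iff_left hy2).1 h

theorem IsTwoAbsorbing.exists_prime_mul_prime_le {J : Ideal R} (hJ : IsTwoAbsorbing J)
    (h : J ≠ ⊤) : ∃ P Q : Ideal R, P.IsPrime ∧ Q.IsPrime ∧ J ≤ P ∧ J ≤ Q ∧ P * Q ≤ J := by
  obtain ⟨P, hP⟩ := Ideal.nonempty_minimalPrimes h
  rcases hJ.exists_mul_le hP with h | ⟨Q, hQ, -, h⟩
  · exact ⟨P, P, hP.1.1, hP.1.1, hP.1.2, hP.1.2, h⟩
  · exact ⟨P, Q, hP.1.1, hQ.1.1, hP.1.2, hQ.1.2, h⟩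

theorem isTwoAbsorbing_of_isPrime {P : Ideal R} (hP : P.IsPrime) : IsTwoAbsorbing P :=
  fun _ _ _ h => (hP.mem_or_mem h).elim Or.inl fun hc => Or.inr (Or.inl (P.mul_mem_left _ hc))

theorem IsTwoAbsorbing.comap {S : Type*} [CommRing S] {J : Ideal S} (hJ : IsTwoAbsorbing J)
    (f : R →+* S) : IsTwoAbsorbing (J.comap f) := fun a b c h => by
  simpa only [Ideal.mem_comap, map_mul] using hJ (f a) (f b) (f c) (by
    simpa only [Ideal.mem_comap, map_mul] using h)

theorem IsTwoAbsorbing.map_localization {J : Ideal R} (hJ : IsTwoAbsorbing J) (M : Ideal R)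
    [M.IsPrime] : IsTwoAbsorbing (J.map (algebraMap R (Localization.AtPrime M))) := by
  intro a' b' c' h
  obtain ⟨a, u, rfl⟩ := exists_eq_algebraMap_mul_unit M a'
  obtain ⟨b, v, rfl⟩ := exists_eq_algebraMap_mul_unit M b'
  obtain ⟨c, w, rfl⟩ := exists_eq_algebraMap_mul_unit M c'
  have key : ∀ (r : R) (e : (Localization.AtPrime M)ˣ),
      algebraMap R (Localization.AtPrime M) r * e ∈
        J.map (algebraMap R (Localization.AtPrime M)) ↔ ∃ s ∉ M, s * r ∈ J := fun r e => by
    rw [Ideal.mul_unit_mem_iff_mem _ e.isUnit, algebraMap_mem_map_iff]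
  have key2 : ∀ (r t : R) (e f : (Localization.AtPrime M)ˣ),
      algebraMap R (Localization.AtPrime M) r * e * (algebraMap R (Localization.AtPrime M) t * f) ∈
        J.map (algebraMap R (Localization.AtPrime M)) ↔ ∃ s ∉ M, s * (r * t) ∈ J :=
    fun r t e f => by
      rw [mul_mul_mul_comm, ← map_mul, ← Units.val_mul, key]
  have habc : algebraMap R (Localization.AtPrime M) a * u * (algebraMap R _ b * v) *
      (algebraMap R _ c * w) = algebraMap R (Localization.AtPrime M) a * u *
        (algebraMap R _ (b * c) * (v * w : (Localization.AtPrime M)ˣ)) := by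
    rw [map_mul, Units.val_mul]
    ring
  rw [habc, key2] at h
  rw [key2, key2, key2]
  obtain ⟨s, hs, h⟩ := h
  -- The denominator `s` is absorbed into one factor before 2-absorption is used.
  rcases hJ (s * a) b c (by convert h using 1; ring) with h | h | h
  · exact Or.inl ⟨s, hs, by rwa [← mul_assoc]⟩
  · exact Or.inr (Or.inl ⟨s, hs, by rwa [← mul_assoc]⟩)
  · exact Or.inr (Or.inr ⟨s, hs, J.mul_mem_left s h⟩)

theorem map_multiset_prod {S : Type*} [CommRing S] (f : R →+* S) (s : Multiset (Ideal R)) :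
    s.prod.map f = (s.map (Ideal.map f)).prod :=
  _root_.map_multiset_prod (Ideal.mapHom f) s

theorem IsTAFRing.localization (hR : IsTAFRing R) (M : Ideal R) [M.IsPrime] :
    IsTAFRing (Localization.AtPrime M) := by
  intro A hA
  obtain ⟨s, hs, hsA⟩ := hR (A.comap (algebraMap R _)) fun h =>
    hA ((Ideal.comap_eq_top_iff).1 h)
  refine ⟨s.map (Ideal.map (algebraMap R _)), fun J hJ => ?_, ?_⟩
  · obtain ⟨J, hJs, rfl⟩ := Multiset.mem_map.1 hJ
    exact (hs J hJs).map_localization M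
  · rw [← map_multiset_prod, hsA, map_comap_localization]

end TwoAbsorbing

/-! ### Primes of local TAF-rings. -/

section Local

variable {D : Type*} [CommRing D] [IsLocalRing D]

/-- Modulo `P` this says that factors of a nonzero principal ideal of a local domain are principal.
Some product `u v` is a unit times `b`, as otherwise `b ∈ b m`; for `w ∈ J₁`, cancelling `v` in `w v
∈ (u v)` gives `w ∈ (u)`. -/
theorem exists_le_sup_span_of_mul_eq {P J₁ J₂ : Ideal D} (hP : P.IsPrime) {b : D} (hb : b ∉ P)
    (hle : J₁ * J₂ ≤ P ⊔ Ideal.span {b}) (hmem : b ∈ J₁ * J₂) :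
    ∃ u ∈ J₁, ∃ v ∈ J₂, u * v ∉ P ∧ J₁ ≤ P ⊔ Ideal.span {u} ∧ J₂ ≤ P ⊔ Ideal.span {v} := by
  have hnot : ¬ J₁ * J₂ ≤ P ⊔ Ideal.span {b} * maximalIdeal D := fun h => by
    obtain ⟨p, hp, q, hq, hpq⟩ := Submodule.mem_sup.1 (h hmem)
    obtain ⟨μ, hμ, rfl⟩ := Ideal.mem_span_singleton_mul.1 hq
    have h1 : IsUnit (1 - μ) := by
      by_contra h1
      exact (Ideal.ne_top_iff_one _).1 (maximalIdeal.isMaximal D).ne_top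
        (by simpa using add_mem ((mem_maximalIdeal _).2 h1) hμ)
    refine hb ((Ideal.mul_unit_mem_iff_mem P h1).1 ?_)
    have : b * (1 - μ) = p := by linear_combination -hpq
    rwa [this]
  rw [Ideal.mul_le] at hnot
  push Not at hnot
  obtain ⟨u, hu, v, hv, huv⟩ := hnot
  obtain ⟨p, hp, q, hq, hpq⟩ := Submodule.mem_sup.1 (hle (Ideal.mul_mem_mul hu hv))
  obtain ⟨e, rfl⟩ := Ideal.mem_span_singleton.1 hq
  have he : IsUnit e := by
    by_contra he
    exact huv (hpq ▸ Submodule.add_mem_sup hp (Ideal.mem_span_singleton_mul.2 ⟨e, he, rfl⟩))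
  obtain ⟨f, hf⟩ := he.exists_right_inv
  have huvP : u * v ∉ P := fun h => huv ((le_sup_left : P ≤ _) h)
  refine ⟨u, hu, v, hv, huvP, fun w hw => ?_, fun w hw => ?_⟩
  · obtain ⟨p', hp', q', hq', hpq'⟩ := Submodule.mem_sup.1 (hle (Ideal.mul_mem_mul hw hv))
    obtain ⟨d, rfl⟩ := Ideal.mem_span_singleton.1 hq'
    have hmem' : (w - u * (d * f)) * v ∈ P := by
      have : (w - u * (d * f)) * v = p' - p * (d * f) := by
        linear_combination -hpq' + (d * f) * hpq - b * d * hf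
      rw [this]
      exact P.sub_mem hp' (P.mul_mem_right _ hp)
    have := (hP.mem_or_mem hmem').resolve_right fun h => huvP (P.mul_mem_left _ h)
    rw [← sub_add_cancel w (u * (d * f))]
    exact Submodule.add_mem_sup this (Ideal.mem_span_singleton.2 ⟨_, rfl⟩)
  · obtain ⟨p', hp', q', hq', hpq'⟩ := Submodule.mem_sup.1 (hle (Ideal.mul_mem_mul hu hw))
    obtain ⟨d, rfl⟩ := Ideal.mem_span_singleton.1 hq'
    have hmem' : u * (w - v * (d * f)) ∈ P := by
      have : u * (w - v * (d * f)) = p' - p * (d * f) := by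
        linear_combination -hpq' + (d * f) * hpq - b * d * hf
      rw [this]
      exact P.sub_mem hp' (P.mul_mem_right _ hp)
    have := (hP.mem_or_mem hmem').resolve_left fun h => huvP (P.mul_mem_right _ h)
    rw [← sub_add_cancel w (v * (d * f))]
    exact Submodule.add_mem_sup this (Ideal.mem_span_singleton.2 ⟨_, rfl⟩)

theorem exists_eq_span_singleton_of_mul_eq [IsDomain D] {J₁ J₂ : Ideal D} {b : D} (hb : b ≠ 0)
    (h : J₁ * J₂ = Ideal.span {b}) : ∃ u, u ≠ 0 ∧ J₁ = Ideal.span {u} := by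
  obtain ⟨u, hu, v, -, huv, hle, -⟩ := exists_le_sup_span_of_mul_eq (P := ⊥) Ideal.isPrime_bot
    (b := b) (by simpa using hb) (by rw [h]; exact le_sup_right)
    (by rw [h]; exact Ideal.mem_span_singleton_self b)
  refine ⟨u, ?_, le_antisymm (by simpa using hle) (by simpa [Ideal.span_le] using hu)⟩
  rintro rfl
  simp at huv

theorem le_multiset_prod_of_forall_le {R : Type*} [CommRing R] {A : Ideal R}
    (s : Multiset (Ideal R)) (h : ∀ J ∈ s, A ≤ J) : A ^ s.card ≤ s.prod := by
  induction s using Multiset.induction_on with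
  | empty => simp
  | cons J s ih =>
    rw [Multiset.card_cons, Multiset.prod_cons, pow_succ']
    exact Ideal.mul_mono (h J (Multiset.mem_cons_self _ _))
      (ih fun I hI => h I (Multiset.mem_cons_of_mem hI))

theorem IsTAFRing.le_mul_maximalIdeal (hD : IsTAFRing D) {P : Ideal D} (hP : P.IsPrime) {a : D}
    (ha : a ∈ maximalIdeal D) (haP : a ∉ P)
    (hmin : ∀ Q : Ideal D, Q.IsPrime → P ≤ Q → a ∈ Q → Q = maximalIdeal D) :
    P ≤ P * maximalIdeal D ∧ ∃ k, maximalIdeal D ^ k ≤ P ⊔ Ideal.span {a} := by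
  have hPm : P ≤ maximalIdeal D := le_maximalIdeal hP.ne_top
  -- The exponent 3 forces a splitting into two proper factors: a single 2-absorbing one would
  -- contain `m² ∋ a²`, but `a² ∉ P + (a³)`.
  have hIm : P ⊔ Ideal.span {a ^ 3} ≤ maximalIdeal D :=
    sup_le hPm (by
      rw [Ideal.span_singleton_le_iff_mem]
      exact Ideal.pow_mem_of_mem _ ha 3 (by norm_num))
  have hItop : P ⊔ Ideal.span {a ^ 3} ≠ ⊤ := fun h =>
    (maximalIdeal.isMaximal D).ne_top (eq_top_iff.2 (h ▸ hIm))
  obtain ⟨s, hs, hsI⟩ := hD _ hItop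
  have hsq : ∀ J ∈ s, maximalIdeal D * maximalIdeal D ≤ J := by
    intro J hJ
    by_cases hJtop : J = ⊤
    · rw [hJtop]
      exact le_top
    have hIJ : P ⊔ Ideal.span {a ^ 3} ≤ J := hsI ▸ Ideal.le_of_dvd (Multiset.dvd_prod hJ)
    obtain ⟨P₁, P₂, h₁, h₂, hJ₁, hJ₂, hle⟩ := (hs J hJ).exists_prime_mul_prime_le hJtop
    have aux : ∀ Q : Ideal D, Q.IsPrime → J ≤ Q → Q = maximalIdeal D := fun Q hQ hJQ =>
      hmin Q hQ ((le_sup_left.trans hIJ).trans hJQ) (hQ.mem_of_pow_mem 3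
        (hJQ (hIJ ((le_sup_right : _ ≤ P ⊔ Ideal.span {a ^ 3})
          (Ideal.mem_span_singleton_self _)))))
    rwa [aux P₁ h₁ hJ₁, aux P₂ h₂ hJ₂] at hle
  constructor
  · have hex : ∃ J ∈ s, J ≠ ⊤ := by
      by_contra! h
      refine hItop ?_
      rw [← hsI, ← Ideal.one_eq_top]
      exact Multiset.prod_eq_one fun J hJ => by rw [h J hJ, Ideal.one_eq_top]
    obtain ⟨J₁, hJ₁, hJ₁top⟩ := hex
    obtain ⟨s', rfl⟩ := Multiset.exists_cons_of_mem hJ₁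
    rw [Multiset.prod_cons] at hsI
    have hJ₂top : s'.prod ≠ ⊤ := by
      intro h
      rw [h, Ideal.mul_top] at hsI
      have := hsI ▸ hsq J₁ hJ₁ (Ideal.mul_mem_mul ha ha)
      obtain ⟨p, hp, q, hq, hpq⟩ := Submodule.mem_sup.1 this
      obtain ⟨c, rfl⟩ := Ideal.mem_span_singleton.1 hq
      have hmem : a * (a * (1 - a * c)) ∈ P := by
        have : a * (a * (1 - a * c)) = p := by linear_combination -hpq
        rwa [this]
      have h1 := (hP.mem_or_mem ((hP.mem_or_mem hmem).resolve_left haP)).resolve_left haP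
      exact (Ideal.ne_top_iff_one _).1 (maximalIdeal.isMaximal D).ne_top
        (by simpa using add_mem (hPm h1) (Ideal.mul_mem_right c _ ha))
    obtain ⟨u, hu, v, hv, huv, hle₁, hle₂⟩ := exists_le_sup_span_of_mul_eq hP
      (b := a ^ 3) (fun h => haP (hP.mem_of_pow_mem 3 h)) hsI.le
      (hsI ▸ (le_sup_right : _ ≤ P ⊔ Ideal.span {a ^ 3}) (Ideal.mem_span_singleton_self _))
    have hum := le_maximalIdeal hJ₁top hu
    have hvm := le_maximalIdeal hJ₂top hv
    have hum' : Ideal.span {u} ≤ maximalIdeal D := by rwa [Ideal.span_singleton_le_iff_mem]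
    have hvm' : Ideal.span {v} ≤ maximalIdeal D := by rwa [Ideal.span_singleton_le_iff_mem]
    -- Expand `(P + (u)) (P + (v))`. Since `u v ∉ P`, a multiple of `u v` lying in `P` has its
    -- coefficient in `P`, hence lies in `P m`.
    have hbig : P ≤ P * maximalIdeal D ⊔ Ideal.span {u * v} := by
      refine (le_sup_left.trans hsI.ge).trans ((Ideal.mul_mono hle₁ hle₂).trans ?_)
      rw [Ideal.mul_sup, Ideal.sup_mul, Ideal.sup_mul, Ideal.span_singleton_mul_span_singleton]
      refine sup_le (sup_le ?_ ?_) (sup_le ?_ le_sup_right)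
      · exact (Ideal.mul_mono_right hPm).trans le_sup_left
      · rw [mul_comm]
        exact (Ideal.mul_mono_right hum').trans le_sup_left
      · exact (Ideal.mul_mono_right hvm').trans le_sup_left
    intro p hp
    obtain ⟨q, hq, r, hr, hqr⟩ := Submodule.mem_sup.1 (hbig hp)
    obtain ⟨c, rfl⟩ := Ideal.mem_span_singleton.1 hr
    have hcP : u * v * c ∈ P := by
      have : u * v * c = p - q := by linear_combination hqr
      rw [this]
      exact P.sub_mem hp (Ideal.mul_le_left hq)
    have hc := (hP.mem_or_mem hcP).resolve_left huv
    rw [← hqr]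
    refine add_mem hq ?_
    rw [mul_comm (u * v) c]
    exact Ideal.mul_mem_mul hc (Ideal.mul_mem_left _ u hvm)
  · refine ⟨2 * s.card, ?_⟩
    rw [pow_mul, pow_two]
    refine (le_multiset_prod_of_forall_le s hsq).trans (hsI.le.trans (sup_le_sup_left ?_ P))
    exact Ideal.span_singleton_le_span_singleton.2 (dvd_pow_self a (by norm_num))

theorem IsTAFRing.false_of_isTwoAbsorbing_span [IsDomain D] (hD : IsTAFRing D) {P : Ideal D}
    (hP : P.IsPrime) {a p : D} (ha : a ∈ maximalIdeal D) (haP : a ∉ P)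
    (hmin : ∀ Q : Ideal D, Q.IsPrime → P ≤ Q → a ∈ Q → Q = maximalIdeal D)
    (hpP : p ∈ P) (hp0 : p ≠ 0) (hp : IsTwoAbsorbing (Ideal.span {p}))
    (h : P * P ≤ Ideal.span {p} ∨ Ideal.span {a} * P ≤ Ideal.span {p}) : False := by
  have hPm : P ≤ maximalIdeal D := le_maximalIdeal hP.ne_top
  obtain ⟨h1, k, hk⟩ := hD.le_mul_maximalIdeal hP ha haP hmin
  have hpow : ∀ n : ℕ, P ≤ P * maximalIdeal D ^ n := fun n => by
    induction n with
    | zero => simp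
    | succ n ih =>
      rw [pow_succ', ← mul_assoc]
      exact ih.trans (Ideal.mul_mono_left h1)
  -- `P ⊆ P mᵏ` for every `k`, and some `mᵏ` lies in `P + (a)`.
  have hPP : P ≤ P * P ⊔ Ideal.span {a} * P := by
    refine (hpow k).trans ((Ideal.mul_mono_right hk).trans ?_)
    rw [Ideal.mul_sup, mul_comm P (Ideal.span {a})]
  have hunit : ∀ μ ∈ maximalIdeal D, IsUnit (1 - μ) := fun μ hμ => by
    by_contra h1
    exact (Ideal.ne_top_iff_one _).1 (maximalIdeal.isMaximal D).ne_top
      (by simpa using add_mem ((mem_maximalIdeal _).2 h1) hμ)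
  rcases h with h | h
  -- Case `P² ⊆ (p)`: then `p ∈ (p²) + a P`, so `p ∈ a P` and `P ⊆ a P`. Hence `p = a² y`, and
  -- 2-absorption of `(p)` puts `a` in `P` or makes it a unit.
  · have hP4 : P ≤ Ideal.span {p} * Ideal.span {p} ⊔ Ideal.span {a} * P := by
      have hsq : P * P ≤ Ideal.span {p} * Ideal.span {p} ⊔ Ideal.span {a} * P := by
        refine (Ideal.mul_mono hPP hPP).trans ?_
        rw [Ideal.mul_sup, Ideal.sup_mul]
        refine sup_le (sup_le ?_ ?_) ?_
        · exact (Ideal.mul_mono h h).trans le_sup_left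
        · exact (Ideal.mul_le_left).trans le_sup_right
        · exact (Ideal.mul_le_right).trans le_sup_right
      exact hPP.trans (sup_le hsq le_sup_right)
    have hpa : p ∈ Ideal.span {a} * P := by
      obtain ⟨q, hq, r, hr, hqr⟩ := Submodule.mem_sup.1 (hP4 hpP)
      rw [Ideal.span_singleton_mul_span_singleton] at hq
      obtain ⟨c, rfl⟩ := Ideal.mem_span_singleton.1 hq
      refine (Ideal.mul_unit_mem_iff_mem _
        (hunit (p * c) (Ideal.mul_mem_right _ _ (hPm hpP)))).1 ?_
      have : p * (1 - p * c) = r := by linear_combination -hqr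
      rwa [this]
    have hPa : P ≤ Ideal.span {a} * P := hP4.trans (sup_le
      (Ideal.mul_le_right.trans ((Ideal.span_singleton_le_iff_mem _).2 hpa)) le_rfl)
    obtain ⟨y₁, hy₁, rfl⟩ := Ideal.mem_span_singleton_mul.1 hpa
    obtain ⟨y, hy, rfl⟩ := Ideal.mem_span_singleton_mul.1 (hPa hy₁)
    have hcase : a * y ∈ Ideal.span {a * (a * y)} → False := fun hmem => by
      obtain ⟨c, hc⟩ := Ideal.mem_span_singleton.1 hmem
      have hay : a * y ≠ 0 := right_ne_zero_of_mul hp0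
      exact ha (IsUnit.of_mul_eq_one c (mul_left_cancel₀ hay (by linear_combination -hc)))
    rcases hp a a y (by rw [mul_assoc]; exact Ideal.mem_span_singleton_self _) with h | h | h
    · have := (Ideal.span_singleton_le_iff_mem _).2 hpP h
      exact haP ((hP.mem_or_mem this).elim id id)
    · exact hcase h
    · exact hcase h
  -- Case `a P ⊆ (p)`: then `a P ⊆ p m`, which forces `p ∈ P²`; so `a p ∈ (a P) P ⊆ p P` and `a ∈
  -- P`.
  · have haP' : Ideal.span {a} * P ≤ Ideal.span {p} * maximalIdeal D := by
      refine (Ideal.mul_mono_right hPP).trans ?_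
      rw [Ideal.mul_sup, ← mul_assoc]
      refine sup_le (Ideal.mul_mono h hPm) ?_
      rw [mul_comm (Ideal.span {p})]
      exact Ideal.mul_mono ((Ideal.span_singleton_le_iff_mem _).2 ha) h
    have hp2 : p ∈ P * P := by
      obtain ⟨q, hq, r, hr, hqr⟩ := Submodule.mem_sup.1 (hPP hpP)
      obtain ⟨μ, hμ, rfl⟩ := Ideal.mem_span_singleton_mul.1 (haP' hr)
      refine (Ideal.mul_unit_mem_iff_mem _ (hunit μ hμ)).1 ?_
      have : p * (1 - μ) = q := by linear_combination -hqr
      rwa [this]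
    have hap : a * p ∈ Ideal.span {p} * P := by
      have : a * p ∈ Ideal.span {a} * (P * P) := Ideal.mem_span_singleton_mul.2 ⟨p, hp2, rfl⟩
      rw [← mul_assoc] at this
      exact Ideal.mul_mono_left h this
    obtain ⟨q, hq, hqa⟩ := Ideal.mem_span_singleton_mul.1 hap
    have haq : a = q := mul_left_cancel₀ hp0 (by rw [hqa, mul_comm])
    exact haP (haq ▸ hq)

end Local

open IsLocalRing

/-! ### Dimension and finite character of TAF-domains. -/

section Dimension

variable {R : Type*} [CommRing R] [IsDomain R]

omit [IsDomain R] in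
-- Chooses `a` so that, after localizing at `N`, `J` contains `P²` or `a P`. When `P B ⊆ J` comes
-- from another minimal prime `B`, take `a ∈ B` if `B ≤ M`; otherwise `B` becomes the unit ideal at
-- `N ≤ M`.
theorem exists_minimalPrimes_sup_span {J P M : Ideal R} (hJ : IsTwoAbsorbing J)
    (hP : P ∈ J.minimalPrimes) (hM : M.IsPrime) (hPM : P < M) :
    ∃ a ∉ P, ∃ N ∈ (P ⊔ Ideal.span {a}).minimalPrimes,
      ∃ B : Ideal R, (B = P ∨ a ∈ B ∨ ¬ B ≤ N) ∧ P * B ≤ J := by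
  have aux : ∀ a ∈ M, ∃ N ∈ (P ⊔ Ideal.span {a}).minimalPrimes, N ≤ M := fun a ha =>
    Ideal.exists_minimalPrimes_le (sup_le hPM.le ((Ideal.span_singleton_le_iff_mem _).2 ha))
  obtain ⟨a₀, ha₀, ha₀P⟩ := SetLike.exists_of_lt hPM
  rcases hJ.exists_mul_le hP with h | ⟨Q, hQ, hne, h⟩
  · obtain ⟨N, hN, -⟩ := aux a₀ ha₀
    exact ⟨a₀, ha₀P, N, hN, P, Or.inl rfl, h⟩
  by_cases hQM : Q ≤ M
  · obtain ⟨a, haQ, haP⟩ := SetLike.not_le_iff_exists.1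
      fun h => hne (le_antisymm h (hP.2 hQ.1 h))
    obtain ⟨N, hN, -⟩ := aux a (hQM haQ)
    exact ⟨a, haP, N, hN, Q, Or.inr (Or.inl haQ), h⟩
  · obtain ⟨N, hN, hNM⟩ := aux a₀ ha₀
    exact ⟨a₀, ha₀P, N, hN, Q, Or.inr (Or.inr fun h => hQM (h.trans hNM)), h⟩

theorem IsTAFRing.isMaximal_of_isPrime (hR : IsTAFRing R) {P₀ : Ideal R} (hP₀ : P₀.IsPrime)
    (h0 : P₀ ≠ ⊥) : P₀.IsMaximal := by
  by_contra hmax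
  obtain ⟨M, hM, hle⟩ := Ideal.exists_le_maximal P₀ hP₀.ne_top
  have hlt : P₀ < M := lt_of_le_of_ne hle fun h => hmax (h ▸ hM)
  obtain ⟨x, hx, hx0⟩ := Submodule.exists_mem_ne_zero_of_ne_bot h0
  -- Minimality over `(x)` makes `P` minimal over a 2-absorbing factor `J` of `(x)`, and such a
  -- factor becomes principal after localization.
  obtain ⟨P, hP, hPP₀⟩ := Ideal.exists_minimalPrimes_le (I := Ideal.span {x})
    ((Ideal.span_singleton_le_iff_mem P₀).2 hx)
  have hPp : P.IsPrime := hP.1.1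
  obtain ⟨s, hs, hsx⟩ := hR (Ideal.span {x}) fun h =>
    hPp.ne_top (eq_top_iff.2 (h ▸ hP.1.2))
  obtain ⟨J, hJs, hJP⟩ := (hPp.multiset_prod_le).1 (hsx.trans_le hP.1.2)
  have hJx : Ideal.span {x} ≤ J := hsx ▸ Ideal.le_of_dvd (Multiset.dvd_prod hJs)
  have hPJ : P ∈ J.minimalPrimes :=
    ⟨⟨hPp, hJP⟩, fun Q hQ hQP => hP.2 ⟨hQ.1, hJx.trans hQ.2⟩ hQP⟩
  obtain ⟨a, haP, N, hN, B, hB, hPB⟩ := exists_minimalPrimes_sup_span (hs J hJs) hPJ hM.isPrime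
    (hPP₀.trans_lt hlt)
  have hNp : N.IsPrime := hN.1.1
  have hPN : P ≤ N := le_sup_left.trans hN.1.2
  have haN : a ∈ N := hN.1.2 ((le_sup_right : _ ≤ P ⊔ Ideal.span {a})
    (Ideal.mem_span_singleton_self a))
  let f := algebraMap R (Localization.AtPrime N)
  have hdisj : Disjoint (N.primeCompl : Set R) (P : Set R) :=
    Set.disjoint_left.2 fun z hz hzP => hz (hPN hzP)
  have hPf : (P.map f).IsPrime :=
    IsLocalization.isPrime_of_isPrime_disjoint N.primeCompl _ P hPp hdisj
  have hcomap : (P.map f).comap f = P :=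
    IsLocalization.under_map_of_isPrime_disjoint N.primeCompl _ hPp hdisj
  have haf : f a ∉ P.map f := fun h => haP (hcomap ▸ Ideal.mem_comap.2 h)
  have hNf : N.map f = maximalIdeal (Localization.AtPrime N) :=
    Localization.AtPrime.map_eq_maximalIdeal
  obtain ⟨s', rfl⟩ := Multiset.exists_cons_of_mem hJs
  have hprod : J.map f * s'.prod.map f = Ideal.span {f x} := by
    rw [← Ideal.map_mul, ← Multiset.prod_cons, hsx, Ideal.map_span, Set.image_singleton]
  obtain ⟨p, hp0, hJp⟩ := exists_eq_span_singleton_of_mul_eq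
    ((algebraMap_localization_ne_zero N).2 hx0) hprod
  have hPBf : P.map f * B.map f ≤ Ideal.span {p} := by
    rw [← hJp, ← Ideal.map_mul]
    exact Ideal.map_mono hPB
  refine (hR.localization N).false_of_isTwoAbsorbing_span hPf (a := f a) (p := p)
    (hNf ▸ Ideal.mem_map_of_mem f haN) haf (fun Q hQ hPQ haQ => ?_) ?_ hp0
    (hJp ▸ (hs J hJs).map_localization N) ?_
  · refine le_antisymm (le_maximalIdeal hQ.ne_top) ?_
    rw [← hNf, Ideal.map_le_iff_le_comap]
    refine hN.2 ⟨hQ.comap f, sup_le (Ideal.map_le_iff_le_comap.1 hPQ)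
      ((Ideal.span_singleton_le_iff_mem _).2 haQ)⟩ ?_
    have : (maximalIdeal (Localization.AtPrime N)).comap f = N :=
      Localization.AtPrime.under_maximalIdeal
    exact (Ideal.comap_mono (le_maximalIdeal hQ.ne_top)).trans this.le
  · exact (hJp.symm.le.trans (Ideal.map_mono hJP)) (Ideal.mem_span_singleton_self p)
  · rcases hB with rfl | haB | hBN
    · exact Or.inl hPBf
    · right
      rw [mul_comm]
      exact (Ideal.mul_mono_right ((Ideal.span_singleton_le_iff_mem _).2
        (Ideal.mem_map_of_mem f haB))).trans hPBf
    · left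
      obtain ⟨b, hb, hbN⟩ := SetLike.not_le_iff_exists.1 hBN
      have htop : B.map f = ⊤ := map_eq_top_of_notMem N hb hbN
      rw [htop, Ideal.mul_top] at hPBf
      exact Ideal.mul_le_right.trans hPBf

theorem IsTAFRing.ringKrullDim_le_one (hR : IsTAFRing R) : ringKrullDim R ≤ 1 := by
  have : Ring.KrullDimLE 1 R := Ring.krullDimLE_one_iff_of_noZeroDivisors.2
    fun I hI hI' => hR.isMaximal_of_isPrime hI' hI
  exact_mod_cast Ring.krullDimLE_iff.1 this

/-- Each proper factor of `(x)` contains a product of two nonzero, hence maximal, primes, so at most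
two maximal ideals contain it. -/
theorem IsTAFRing.hasFiniteCharacter (hR : IsTAFRing R) : HasFiniteCharacter R := by
  classical
  intro x hx hxu
  obtain ⟨s, hs, hsx⟩ := hR (Ideal.span {x}) (by rwa [Ne, Ideal.span_singleton_eq_top])
  have hfin : ∀ J ∈ s, {M : Ideal R | M.IsMaximal ∧ J ≤ M}.Finite := by
    intro J hJ
    by_cases htop : J = ⊤
    · refine Set.finite_empty.subset fun M hM => hM.1.ne_top (eq_top_iff.2 (htop ▸ hM.2))
    obtain ⟨P, Q, hP, hQ, hJP, hJQ, hle⟩ := (hs J hJ).exists_prime_mul_prime_le htop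
    have hxJ : x ∈ J := (hsx ▸ Ideal.le_of_dvd (Multiset.dvd_prod hJ) : Ideal.span {x} ≤ J)
      (Ideal.mem_span_singleton_self x)
    have hmax : ∀ P : Ideal R, P.IsPrime → J ≤ P → P.IsMaximal := fun P hP hJP =>
      hR.isMaximal_of_isPrime hP fun h => hx (by simpa [h] using hJP hxJ)
    refine (Set.toFinite {P, Q}).subset fun M hM => ?_
    rcases (hM.1.isPrime.mul_le).1 (hle.trans hM.2) with h | h
    · exact Or.inl ((hmax P hP hJP).eq_of_le hM.1.ne_top h).symm
    · exact Or.inr ((hmax Q hQ hJQ).eq_of_le hM.1.ne_top h).symm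
  refine (Set.Finite.biUnion s.toFinset.finite_toSet
    fun J hJ => hfin J (Multiset.mem_toFinset.1 hJ)).subset fun M hM => ?_
  obtain ⟨J, hJ, hJM⟩ := (hM.1.isPrime.multiset_prod_le).1
    (hsx.trans_le ((Ideal.span_singleton_le_iff_mem M).2 hM.2))
  exact Set.mem_biUnion (Multiset.mem_toFinset.2 hJ) ⟨hM.1, hJM⟩

end Dimension

/-! ### Orders in local TAF-domains. -/

section LocalTAF

variable {D : Type*} [CommRing D] [IsDomain D] [IsLocalRing D]

/-- Every nonzero element of a local TAF-domain has an order with respect to the maximal ideal. -/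
theorem IsTAFRing.exists_order (hD : IsTAFRing D) {x : D} (hx : x ≠ 0) :
    ∃ n, x ∈ maximalIdeal D ^ n ∧
      Ideal.span {x} * maximalIdeal D = maximalIdeal D ^ (n + 1) := by
  suffices ∃ n, Ideal.span {x} ≤ maximalIdeal D ^ n ∧
      Ideal.span {x} * maximalIdeal D = maximalIdeal D ^ (n + 1) by
    simpa only [Ideal.span_singleton_le_iff_mem] using this
  by_cases htop : Ideal.span {x} = ⊤
  · exact ⟨0, by simp, by simp [htop]⟩
  obtain ⟨s, hs, hsx⟩ := hD _ htop
  have hmain : ∀ J ∈ s, ∃ n, J ≤ maximalIdeal D ^ n ∧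
      J * maximalIdeal D = maximalIdeal D ^ (n + 1) := by
    intro J hJ
    by_cases hJtop : J = ⊤
    · exact ⟨0, by simp, by simp [hJtop]⟩
    have hxJ : x ∈ J := (hsx ▸ Ideal.le_of_dvd (Multiset.dvd_prod hJ) : Ideal.span {x} ≤ J)
      (Ideal.mem_span_singleton_self x)
    have hJsq : maximalIdeal D * maximalIdeal D ≤ J := by
      obtain ⟨P, Q, hP, hQ, hJP, hJQ, hle⟩ := (hs J hJ).exists_prime_mul_prime_le hJtop
      have hmax : ∀ P : Ideal D, P.IsPrime → J ≤ P → P = maximalIdeal D := fun P hP hJP =>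
        eq_maximalIdeal (hD.isMaximal_of_isPrime hP fun h => hx (by simpa [h] using hJP hxJ))
      rwa [hmax P hP hJP, hmax Q hQ hJQ] at hle
    have hJm := le_maximalIdeal hJtop
    -- A proper factor has order 1 or 2: if `J m ≠ m²`, then `J = (y)` and `m²` contains a unit
    -- multiple of `y`, so `J = m²`.
    by_cases hle : maximalIdeal D * maximalIdeal D ≤ J * maximalIdeal D
    · exact ⟨1, by simpa using hJm, by
        rw [pow_two]
        exact le_antisymm (Ideal.mul_mono_left hJm) hle⟩
    · obtain ⟨s', rfl⟩ := Multiset.exists_cons_of_mem hJ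
      rw [Multiset.prod_cons] at hsx
      obtain ⟨y, -, rfl⟩ := exists_eq_span_singleton_of_mul_eq hx hsx
      obtain ⟨w, hw, hwy⟩ := SetLike.not_le_iff_exists.1 hle
      obtain ⟨c, rfl⟩ := Ideal.mem_span_singleton.1 (hJsq hw)
      have hc : IsUnit c := by
        by_contra hc
        exact hwy (Ideal.mem_span_singleton_mul.2 ⟨c, hc, rfl⟩)
      have hy : Ideal.span {y} = maximalIdeal D * maximalIdeal D :=
        le_antisymm ((Ideal.span_singleton_le_iff_mem _).2
          ((Ideal.mul_unit_mem_iff_mem _ hc).1 hw)) hJsq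
      exact ⟨2, by rw [hy, pow_two], by rw [hy, pow_succ, pow_two]⟩
  rw [← hsx]
  clear hs hsx
  induction s using Multiset.induction_on with
  | empty => exact ⟨0, by simp, by simp⟩
  | cons J s ih =>
    obtain ⟨n, hn, hn'⟩ := hmain J (Multiset.mem_cons_self _ _)
    obtain ⟨k, hk, hk'⟩ := ih fun I hI => hmain I (Multiset.mem_cons_of_mem hI)
    refine ⟨n + k, ?_, ?_⟩
    · rw [Multiset.prod_cons, pow_add]
      exact Ideal.mul_mono hn hk
    · rw [Multiset.prod_cons, mul_assoc, hk', pow_succ', ← mul_assoc, hn', ← pow_add]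
      congr 1
      ring

theorem notMem_span_singleton_mul_maximalIdeal {x : D} (hx : x ≠ 0) :
    x ∉ Ideal.span {x} * maximalIdeal D := by
  intro h
  obtain ⟨q, hq, hxq⟩ := Ideal.mem_span_singleton_mul.1 h
  have : q = 1 := mul_left_cancel₀ hx (by rw [hxq, mul_one])
  exact (Ideal.ne_top_iff_one _).1 (maximalIdeal.isMaximal D).ne_top (this ▸ hq)

theorem IsTAFRing.isPVD (hD : IsTAFRing D) : IsPVD D := by
  refine isPVD_of_isStronglyPrime_maximalIdeal (isStronglyPrime_iff.2 ?_)
  rintro a b c d hb hd ⟨p, hp, hac⟩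
  by_cases ha : a = 0
  · exact Or.inl ⟨0, zero_mem _, by simp [ha]⟩
  obtain ⟨n, han, hn⟩ := hD.exists_order ha
  obtain ⟨k, hbk, hk⟩ := hD.exists_order hb
  -- If `b` has smaller order than `a`, then `a ∈ m^(k+1) = b m`. Otherwise `b m ⊆ a m`, so `b p = a
  -- q` with `q ∈ m`, and `c = d q`.
  rcases lt_or_ge k n with hkn | hnk
  · have : a ∈ Ideal.span {b} * maximalIdeal D := hk ▸ Ideal.pow_le_pow_right hkn han
    obtain ⟨q, hq, h⟩ := Ideal.mem_span_singleton_mul.1 this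
    exact Or.inl ⟨q, hq, h.symm⟩
  · have hle : Ideal.span {b} * maximalIdeal D ≤ Ideal.span {a} * maximalIdeal D := by
      rw [hn, hk]
      exact Ideal.pow_le_pow_right (by omega)
    obtain ⟨q, hq, h⟩ := Ideal.mem_span_singleton_mul.1
      (hle (Ideal.mem_span_singleton_mul.2 ⟨p, hp, rfl⟩))
    exact Or.inr ⟨q, hq, mul_left_cancel₀ ha (by linear_combination hac - d * h)⟩

/-- Some `j ∈ I` has order exactly `k`. For `c / d ∈ D : I`, the element `e = c j / d` is a nonunit
unless `I = (j)`. Then `e mᵏ ⊆ m^(k+1) = j m`, so `(c / d) mᵏ ⊆ D`. -/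
theorem IsTAFRing.eq_span_singleton_or_pow_le (hD : IsTAFRing D) {I : Ideal D}
    (hI : IsDivisorial I) {k : ℕ} (hle : I ≤ maximalIdeal D ^ k)
    (hnot : ¬ I ≤ maximalIdeal D ^ (k + 1)) :
    (∃ x, I = Ideal.span {x}) ∨ maximalIdeal D ^ k ≤ I := by
  by_contra! hcon
  obtain ⟨hnp, hcon⟩ := hcon
  refine hcon fun w hw => (isDivisorial_iff.1 hI).2 fun c d hd h => ?_
  by_cases hc : c = 0
  · simp [hc]
  obtain ⟨j, hj, hjk⟩ := SetLike.not_le_iff_exists.1 hnot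
  have hj0 : j ≠ 0 := by
    rintro rfl
    exact hjk (zero_mem _)
  have hord : Ideal.span {j} * maximalIdeal D = maximalIdeal D ^ (k + 1) := by
    obtain ⟨n, hjn, hn⟩ := hD.exists_order hj0
    rcases lt_trichotomy n k with h | rfl | h
    · exact absurd (hn ▸ Ideal.pow_le_pow_right h (hle hj))
        (notMem_span_singleton_mul_maximalIdeal hj0)
    · exact hn
    · exact absurd (Ideal.pow_le_pow_right h hjn) hjk
  obtain ⟨e, he⟩ := h j hj
  have hem : e ∈ maximalIdeal D := by
    by_contra hem
    refine hnp j (le_antisymm (fun x hx => ?_) ((Ideal.span_singleton_le_iff_mem _).2 hj))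
    obtain ⟨f, hf⟩ := h x hx
    refine Ideal.mem_span_singleton.2 ((notMem_maximalIdeal.1 hem).dvd_mul_left.1 ⟨f, ?_⟩)
    exact mul_left_cancel₀ hd (by linear_combination j * hf - x * he)
  have hew : e * w ∈ Ideal.span {j} * maximalIdeal D := by
    rw [hord, pow_succ']
    exact Ideal.mul_mem_mul hem hw
  obtain ⟨q, -, hq⟩ := Ideal.mem_span_singleton_mul.1 hew
  exact ⟨q, mul_left_cancel₀ hj0 (by linear_combination w * he - d * hq)⟩

theorem IsTAFRing.isMori (hD : IsTAFRing D) : IsMori D := by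
  classical
  refine isMori_of_exists_maximal fun S hS hd => ?_
  have hex : ∃ k, ∃ I ∈ S, ¬ I ≤ maximalIdeal D ^ (k + 1) := by
    obtain ⟨I, hI⟩ := hS
    obtain ⟨x, hx, hx0⟩ := Submodule.exists_mem_ne_zero_of_ne_bot (hd I hI).1
    obtain ⟨n, -, hn⟩ := hD.exists_order hx0
    exact ⟨n, I, hI, fun h => notMem_span_singleton_mul_maximalIdeal hx0 (hn ▸ h hx)⟩
  obtain ⟨I, hI, hIk⟩ := Nat.find_spec hex
  set k := Nat.find hex with hk
  have hle : ∀ J ∈ S, J ≤ maximalIdeal D ^ k := fun J hJ => by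
    rcases Nat.eq_zero_or_pos k with h0 | hpos
    · simp [h0]
    · by_contra h
      refine Nat.find_min hex (m := k - 1) (by omega) ⟨J, hJ, ?_⟩
      rwa [Nat.sub_add_cancel hpos]
  -- By minimality of `k` all members of `S` lie in `mᵏ`, so a member containing `mᵏ` is the
  -- largest. Without one, `I` and the members above it are principal, and a proper inclusion would
  -- push `I` into `m^(k+1)`.
  by_cases hpow : ∃ J ∈ S, maximalIdeal D ^ k ≤ J
  · obtain ⟨J, hJ, hkJ⟩ := hpow
    exact ⟨J, hJ, fun J' hJ' h => le_antisymm ((hle J' hJ').trans hkJ) h⟩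
  push Not at hpow
  have hprin : ∀ J ∈ S, I ≤ J → ∃ x, J = Ideal.span {x} := fun J hJ hIJ =>
    (hD.eq_span_singleton_or_pow_le (hd J hJ) (hle J hJ)
      fun h => hIk (hIJ.trans h)).resolve_right (hpow J hJ)
  refine ⟨I, hI, fun J hJ hIJ => le_antisymm ?_ hIJ⟩
  obtain ⟨x, rfl⟩ := hprin I hI le_rfl
  obtain ⟨y, rfl⟩ := hprin J hJ hIJ
  obtain ⟨c, rfl⟩ := Ideal.span_singleton_le_span_singleton.1 hIJ
  have hc : IsUnit c := by
    by_contra hc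
    refine hIk ((Ideal.span_singleton_le_iff_mem _).2 ?_)
    rw [pow_succ]
    exact Ideal.mul_mem_mul (hle _ hJ (Ideal.mem_span_singleton_self y)) hc
  exact Ideal.span_singleton_le_span_singleton.2 (hc.mul_right_dvd.2 dvd_rfl)

end LocalTAF

/-! ### From local factorizations to global ones. -/

section Globalization

variable {R : Type*} [CommRing R] [IsDomain R]

theorem exists_multiset_of_localization {I : Ideal R} (hI : I ≠ ⊥) (M : Ideal R) [M.IsMaximal]
    (hM : IsMori (Localization.AtPrime M)) (hP : IsPVD (Localization.AtPrime M)) :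
    ∃ s : Multiset (Ideal R), (∀ J ∈ s, IsTwoAbsorbing J) ∧
      s.prod.map (algebraMap R (Localization.AtPrime M)) =
        I.map (algebraMap R (Localization.AtPrime M)) ∧
      ∀ (N : Ideal R) [N.IsMaximal], N ≠ M →
        s.prod.map (algebraMap R (Localization.AtPrime N)) = ⊤ := by
  by_cases htop : I.map (algebraMap R (Localization.AtPrime M)) = ⊤
  · exact ⟨0, by simp, by simp [htop, Ideal.one_eq_top, Ideal.map_top], fun N _ _ => by
      simp [Ideal.one_eq_top, Ideal.map_top]⟩
  obtain ⟨s, hs, hsI⟩ := hP.exists_prod_eq hM (map_localization_ne_bot M hI) htop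
  refine ⟨s.map (Ideal.comap (algebraMap R (Localization.AtPrime M))), fun J hJ => ?_, ?_,
    fun N _ hNM => ?_⟩
  · obtain ⟨A, hA, rfl⟩ := Multiset.mem_map.1 hJ
    exact (isTwoAbsorbing_of_sq_maximalIdeal_le (hs A hA)).comap _
  · rw [map_multiset_prod, Multiset.map_map, ← hsI]
    simp only [Function.comp_def, map_comap_localization, Multiset.map_id']
  -- Each contracted factor contains `z²` for `z ∈ M \ N`, because its local original contains the
  -- square of the maximal ideal.
  · obtain ⟨z, hz, hzN⟩ := SetLike.not_le_iff_exists.1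
      fun h => hNM (‹M.IsMaximal›.eq_of_le ‹N.IsMaximal›.ne_top h).symm
    rw [map_multiset_prod, Multiset.map_map]
    rw [← Ideal.one_eq_top]
    refine Multiset.prod_eq_one fun B hB => ?_
    obtain ⟨A, hA, rfl⟩ := Multiset.mem_map.1 hB
    rw [Ideal.one_eq_top]
    refine map_eq_top_of_notMem N (x := z * z) ?_
      fun h => (‹N.IsMaximal›.isPrime.mem_or_mem h).elim hzN hzN
    have hzm : algebraMap R (Localization.AtPrime M) z ∈
        maximalIdeal (Localization.AtPrime M) := by
      rw [← Localization.AtPrime.map_eq_maximalIdeal]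
      exact Ideal.mem_map_of_mem _ hz
    rw [Ideal.mem_comap, map_mul]
    exact hs A hA (Ideal.mul_mem_mul hzm hzm)

theorem isTAFRing_of_hasFiniteCharacter (hfc : HasFiniteCharacter R)
    (h : ∀ (M : Ideal R) [M.IsMaximal],
      IsMori (Localization.AtPrime M) ∧ IsPVD (Localization.AtPrime M)) : IsTAFRing R := by
  classical
  intro I hItop
  by_cases hI : I = ⊥
  · refine ⟨{⊥}, fun J hJ => ?_, by simp [hI]⟩
    rw [Multiset.mem_singleton.1 hJ]
    exact isTwoAbsorbing_of_isPrime Ideal.isPrime_bot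
  obtain ⟨x, hx, hx0⟩ := Submodule.exists_mem_ne_zero_of_ne_bot hI
  have hfin := finite_maximal_of_hasFiniteCharacter hfc hx0
  have hex : ∀ M : MaximalSpectrum R, ∃ s : Multiset (Ideal R),
      (∀ J ∈ s, IsTwoAbsorbing J) ∧
      s.prod.map (algebraMap R (Localization.AtPrime M.asIdeal)) =
        I.map (algebraMap R (Localization.AtPrime M.asIdeal)) ∧
      ∀ (N : Ideal R) [N.IsMaximal], N ≠ M.asIdeal →
        s.prod.map (algebraMap R (Localization.AtPrime N)) = ⊤ := fun M =>
    exists_multiset_of_localization hI M.asIdeal (h M.asIdeal).1 (h M.asIdeal).2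
  choose s hs hsM hsN using hex
  have hfin' : {M : MaximalSpectrum R | x ∈ M.asIdeal}.Finite :=
    Set.Finite.of_finite_image (f := MaximalSpectrum.asIdeal)
      (hfin.subset (by rintro _ ⟨M, hM, rfl⟩; exact ⟨M.isMaximal, hM⟩))
      fun _ _ _ _ h => MaximalSpectrum.ext h
  refine ⟨∑ M ∈ hfin'.toFinset, s M, fun J hJ => ?_, ?_⟩
  · obtain ⟨M, -, hM⟩ := Multiset.mem_sum.1 hJ
    exact hs M J hM
  rw [Multiset.prod_sum]
  refine Ideal.eq_of_localization_maximal fun N hN => ?_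
  have hprod : (∏ M ∈ hfin'.toFinset, (s M).prod).map (algebraMap R (Localization.AtPrime N)) =
      ∏ M ∈ hfin'.toFinset, (s M).prod.map (algebraMap R (Localization.AtPrime N)) :=
    map_prod (Ideal.mapHom (algebraMap R (Localization.AtPrime N))) _ _
  -- At `N` only the factors built from `N` survive; if `x ∉ N`, both sides are the unit ideal.
  rw [hprod, Finset.prod_eq_single (⟨N, hN⟩ : MaximalSpectrum R)]
  · exact hsM ⟨N, hN⟩
  · intro M _ hMN
    rw [Ideal.one_eq_top]
    exact hsN M N fun h => hMN (MaximalSpectrum.ext h.symm)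
  · intro hNF
    have hxN : x ∉ N := by simpa using hNF
    rw [hsM ⟨N, hN⟩, Ideal.one_eq_top]
    exact map_eq_top_of_notMem N hx hxN

end Globalization

end TAF

theorem proposition3p5 (R : Type*) [CommRing R] [IsDomain R] :
    List.TFAE
      [ TAF.IsTAFRing R,
        TAF.HasFiniteCharacter R ∧
          ∀ (M : Ideal R) [M.IsMaximal],
            TAF.IsMori (Localization.AtPrime M) ∧ TAF.IsPVD (Localization.AtPrime M),
        TAF.IsMori R ∧ TAF.IsLPVD R,
        TAF.IsSeminormal R ∧ TAF.IsMori R ∧ TAF.IsLocallyConducive R ] ∧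
    (TAF.IsTAFRing R → ringKrullDim R ≤ 1) := by
  refine ⟨?_, TAF.IsTAFRing.ringKrullDim_le_one⟩
  tfae_have 1 → 2 := fun h => ⟨h.hasFiniteCharacter, fun M _ =>
    ⟨(h.localization M).isMori, (h.localization M).isPVD⟩⟩
  tfae_have 2 → 1 := fun h => TAF.isTAFRing_of_hasFiniteCharacter h.1 h.2
  tfae_have 2 → 3 := fun h =>
    ⟨TAF.isMori_of_hasFiniteCharacter h.1 fun M _ => (h.2 M).1, fun M _ => (h.2 M).2⟩
  tfae_have 3 → 2 := fun h =>
    ⟨h.1.hasFiniteCharacter h.2, fun M _ => ⟨h.1.localization M, h.2 M⟩⟩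
  tfae_have 3 → 4 := fun h =>
    ⟨TAF.isSeminormal_of_isLPVD h.2, h.1, fun M _ => (h.2 M).isConducive (h.1.localization M)⟩
  tfae_have 4 → 3 := fun h =>
    ⟨h.2.1, fun M _ => (h.1.localization M).isPVD (h.2.1.localization M) (h.2.2 M)⟩
  tfae_finish
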